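/- Call a topological space \emph{orderable} if its topology is the order topology of some linear order on it, i.e. the topology generated by the open intervals (including unbounded ones). Call a topological space $X$ \emph{regularly locally ordered} if every point of $X$ has a neighbourhood whose closure in $X$, with the subspace topology, is orderable. Every second-countable, regularly locally ordered space $X$ is homeomorphic to a disjoint union (topological sum) of at most countably many copies of the unit circle and a subspace of the real line: there are a (finite or infinite, possibly empty) countable index set $I$ and a (possibly empty) subset $S\subseteq\mathbb{R}$ such that $$X\;\cong\;\Bigl(\bigsqcup_{i\in I} S^1\Bigr)\sqcup S .$$ -/

import Mathlib

open Topology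

/-- A topological space is orderable if its topology is the order topology (generated by open
intervals, including unbounded ones) of some linear order on it. -/
def OrderableSpace (X : Type*) [TopologicalSpace X] : Prop :=
  ∃ _ : LinearOrder X, OrderTopology X

/-- A topological space is regularly locally ordered if each point has a neighbourhood whose
closure, with the subspace topology, is orderable. -/
def RegularlyLocallyOrdered (X : Type*) [TopologicalSpace X] : Prop :=
  ∀ x : X, ∃ U ∈ 𝓝 x, OrderableSpace (closure U)

open Set Filter

/-! Every point has a clopen neighbourhood that is a circle or embeds in ℝ
(`RegularlyLocallyOrdered.exists_isClopen`); countably many such sets, made disjoint, then give the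
decomposition.

To find the neighbourhood, note that X is T3 and that second-countable ordered spaces embed in ℝ
(`exists_strictMono_continuous`), so Tietze extension provides small closed charts centred at any
point q. If the chart values have gaps on both sides of 0, cutting at the gaps leaves a clopen set.
Otherwise q lies in the closure of an open arc, and by Zorn of a maximal one, parametrised by `e : ℝ
→ X`. An end of `e` that clusters at a point converges to it and fills one side of a chart there.

If both ends have a common limit, they fill opposite sides of it, and the arc with this point added
is a clopen circle (`isClopen_insert_range`). If not, maximality forces a gap in the chart beyond
each limit (`IsEndChart.exists_notMem_image`). Adding the chart up to that gap at each end gives a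
clopen set, and its two halves glue to an embedding in ℝ
(`exists_isClopen_isEmbeddingOn_of_maximal`). -/

/-- The restriction of `g` to `A` is a topological embedding. -/
def IsEmbeddingOn {X : Type*} [TopologicalSpace X] (g : X → ℝ) (A : Set X) : Prop :=
  InjOn g A ∧ ∀ x ∈ A, 𝓝[A] x = comap g (𝓝 (g x)) ⊓ 𝓟 A

/-! ### Embeddings of subsets into the line, and gluing. -/

section EmbeddingOn

variable {X : Type*} [TopologicalSpace X]

theorem isEmbeddingOn_iff {g : X → ℝ} {A : Set X} :
    IsEmbeddingOn g A ↔ IsEmbedding (A.domRestrict g) := by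
  rw [isEmbedding_iff, ← injOn_iff_injective, and_comm, isInducing_iff_nhds]
  refine and_congr_right fun _ => ?_
  rw [Subtype.forall]
  refine forall₂_congr fun x hx => ?_
  have h : 𝓝[A] x = map (Subtype.val : A → X) (𝓝 ⟨x, hx⟩) := (map_nhds_subtype_val ⟨x, hx⟩).symm
  constructor
  · intro H
    rw [nhds_subtype_eq_comap_nhdsWithin, H, comap_inf, comap_principal]
    simp [domRestrict_eq, comap_comap, Function.comp_def]
  · intro H
    rw [h, H, domRestrict_eq, ← comap_comap, map_comap, Subtype.range_val]
    rfl

theorem IsEmbeddingOn.mono {g : X → ℝ} {A B : Set X} (h : IsEmbeddingOn g B) (hAB : A ⊆ B) :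
    IsEmbeddingOn g A := by
  refine ⟨h.1.mono hAB, fun x hx => ?_⟩
  have := h.2 x (hAB hx)
  rw [← inter_eq_right.2 hAB, nhdsWithin_inter', this, inf_assoc, inf_principal]

theorem IsEmbeddingOn.congr {g g' : X → ℝ} {A : Set X} (h : IsEmbeddingOn g A) (hg : EqOn g g' A) :
    IsEmbeddingOn g' A := by
  rw [isEmbeddingOn_iff] at *
  rwa [← domRestrict_eq_domRestrict_iff.2 hg]

theorem IsEmbeddingOn.comp {g : X → ℝ} {A : Set X} (h : IsEmbeddingOn g A) {k : ℝ → ℝ}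
    (hk : IsEmbedding k) : IsEmbeddingOn (k ∘ g) A := by
  rw [isEmbeddingOn_iff] at *
  exact hk.comp h

/-- Neighbourhoods in a set carrying an embedding contain traces of intervals. -/
theorem IsEmbeddingOn.exists_pos {g : X → ℝ} {A N : Set X} (h : IsEmbeddingOn g A) {x : X}
    (hx : x ∈ A) (hN : N ∈ 𝓝 x) : ∃ ε > 0, ∀ y ∈ A, |g y - g x| < ε → y ∈ N := by
  have h1 : N ∈ 𝓝[A] x := mem_nhdsWithin_of_mem_nhds hN
  rw [h.2 x hx, mem_inf_principal] at h1
  obtain ⟨s, hs, hsN⟩ := h1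
  obtain ⟨ε, hε, hb⟩ := Metric.mem_nhds_iff.1 hs
  exact ⟨ε, hε, fun y hy hyx => hsN (hb (by simpa [Real.dist_eq] using hyx)) hy⟩

/-- Gluing two embeddings along a common extreme point. -/
theorem IsEmbeddingOn.union {g : X → ℝ} {A B : Set X} {p : X} (hA : IsEmbeddingOn g A)
    (hB : IsEmbeddingOn g B) (hpA : p ∈ A) (hpB : p ∈ B)
    (hAp : ∀ x ∈ A, x ≠ p → g x < g p) (hBp : ∀ x ∈ B, x ≠ p → g p < g x)
    (hcA : A ∩ closure B ⊆ B) (hcB : B ∩ closure A ⊆ A) : IsEmbeddingOn g (A ∪ B) := by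
  have hA' : ∀ x ∈ A, g x ≤ g p := fun x hx => by
    by_cases h : x = p
    · rw [h]
    · exact (hAp x hx h).le
  have hB' : ∀ x ∈ B, g p ≤ g x := fun x hx => by
    by_cases h : x = p
    · rw [h]
    · exact (hBp x hx h).le
  have hAB : ∀ x ∈ A, ∀ y ∈ B, g x = g y → x = y := by
    intro x hx y hy hxy
    have h1 : g x = g p := le_antisymm (hA' x hx) (hxy ▸ hB' y hy)
    have h2 : x = p := by by_contra h; exact (hAp x hx h).ne h1
    have h3 : y = p := by by_contra h; exact (hBp y hy h).ne (h1.symm.trans hxy)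
    rw [h2, h3]
  refine ⟨?_, ?_⟩
  · rintro x (hx | hx) y (hy | hy) hxy
    · exact hA.1 hx hy hxy
    · exact hAB x hx y hy hxy
    · exact (hAB y hy x hx hxy.symm).symm
    · exact hB.1 hx hy hxy
  · intro x hx
    -- Compare the traces on `A` and on `B` separately. A point outside one of the sets is away from
    -- it in X by the closure hypotheses, and in ℝ because `g p` separates the values; both traces
    -- are then `⊥`.
    rw [nhdsWithin_union, ← sup_principal, inf_sup_left]
    congr 1
    · by_cases hxA : x ∈ A
      · exact hA.2 x hxA
      · have hxB : x ∈ B := hx.resolve_left hxA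
        have h1 : 𝓝[A] x = ⊥ := by
          by_contra h
          exact hxA (hcB ⟨hxB, mem_closure_iff_nhdsWithin_neBot.2 ⟨h⟩⟩)
        rw [h1, eq_comm, ← disjoint_iff, disjoint_principal_right]
        have hgx : g p < g x := hBp x hxB fun h => hxA (h ▸ hpA)
        exact ⟨Ioi (g p), Ioi_mem_nhds hgx, fun y hy hyA => (hA' y hyA).not_gt hy⟩
    · by_cases hxB : x ∈ B
      · exact hB.2 x hxB
      · have hxA : x ∈ A := hx.resolve_right hxB
        have h1 : 𝓝[B] x = ⊥ := by
          by_contra h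
          exact hxB (hcA ⟨hxA, mem_closure_iff_nhdsWithin_neBot.2 ⟨h⟩⟩)
        rw [h1, eq_comm, ← disjoint_iff, disjoint_principal_right]
        have hgx : g x < g p := hAp x hxA fun h => hxB (h ▸ hpB)
        exact ⟨Iio (g p), Iio_mem_nhds hgx, fun y hy hyB => (hB' y hyB).not_gt hy⟩

end EmbeddingOn

/-! ### Second-countable ordered spaces embed in the line. -/

section OrderEmbedding

variable {Y : Type*} [TopologicalSpace Y] [LinearOrder Y] [OrderTopology Y]

/-- The running supremum of a bounded continuous function is continuous. -/
theorem continuous_iSup_Iic {h : Y → ℝ} (hc : Continuous h) (hb : ∀ y, h y ≤ 1) :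
    Continuous fun x : Y => ⨆ y : Iic x, h (y : Y) := by
  have bdd : ∀ x : Y, BddAbove (range fun y : Iic x => h (y : Y)) := fun x =>
    ⟨1, by rintro _ ⟨y, rfl⟩; exact hb y⟩
  have le : ∀ {x y : Y}, y ≤ x → h y ≤ ⨆ z : Iic x, h (z : Y) := fun {x y} hyx =>
    le_ciSup (bdd x) (⟨y, hyx⟩ : Iic x)
  rw [continuous_iff_continuousAt]
  intro x
  have : ∀ x : Y, Nonempty (Iic x) := fun x => ⟨⟨x, le_rfl⟩⟩
  rw [ContinuousAt, tendsto_order]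
  constructor
  · intro a ha
    obtain ⟨⟨y, hy⟩, hay⟩ := exists_lt_of_lt_ciSup ha
    rcases (show y ≤ x from hy).lt_or_eq with hyx | rfl
    · filter_upwards [Ioi_mem_nhds hyx] with z hz
      exact hay.trans_le (le (le_of_lt hz))
    · filter_upwards [hc.continuousAt.eventually (lt_mem_nhds hay)] with z hz
      exact hz.trans_le (le le_rfl)
  · intro a ha
    obtain ⟨c, hc1, hc2⟩ := exists_between ha
    have hx : h x < c := (le le_rfl).trans_lt hc1
    have hev : {z | h z < c} ∈ 𝓝 x := hc.continuousAt.eventually (gt_mem_nhds hx)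
    -- Beyond `x` the supremum can grow only through values of `h` on `Ioc x z`, which continuity
    -- keeps below `c` for `z` near `x`.
    have key : ∀ z, (∀ w ∈ Ioc x z, h w < c) → ⨆ y : Iic z, h (y : Y) ≤ c := by
      intro z hz
      refine ciSup_le fun ⟨w, hw⟩ => ?_
      rcases le_or_gt w x with hwx | hwx
      · exact (le hwx).trans hc1.le
      · exact (hz w ⟨hwx, hw⟩).le
    by_cases hmax : ∃ u, x < u
    · obtain ⟨u, hu, hsub⟩ := (mem_nhdsGE_iff_exists_Ico_subset' hmax.choose_spec).1
        (mem_nhdsWithin_of_mem_nhds hev : {z | h z < c} ∈ 𝓝[≥] x)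
      filter_upwards [Iio_mem_nhds hu] with z hz
      exact (key z fun w hw => hsub ⟨hw.1.le, hw.2.trans_lt hz⟩).trans_lt hc2
    · push Not at hmax
      refine Eventually.of_forall fun z => (key z fun w hw => ?_).trans_lt hc2
      exact absurd hw.1 (hmax w).not_gt

/-- The subbasic rays at `a` are preimages of the rays at `g a`, so the image need not be
order-convex. -/
theorem isEmbedding_of_strictMono {g : Y → ℝ} (hm : StrictMono g) (hc : Continuous g) :
    IsEmbedding g := by
  refine ⟨⟨le_antisymm hc.le_induced ?_⟩, hm.injective⟩
  rw [OrderTopology.topology_eq_generate_intervals (α := Y)]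
  refine le_generateFrom ?_
  rintro _ ⟨a, rfl | rfl⟩
  · exact ⟨Ioi (g a), isOpen_Ioi, by ext; simp [hm.lt_iff_lt]⟩
  · exact ⟨Iio (g a), isOpen_Iio, by ext; simp [hm.lt_iff_lt]⟩

/-- A second-countable linearly ordered space embeds into the real line, preserving the order. -/
theorem exists_strictMono_continuous [SecondCountableTopology Y] :
    ∃ g : Y → ℝ, StrictMono g ∧ Continuous g := by
  let : MetricSpace Y := TopologicalSpace.metrizableSpaceMetric Y
  let ι := TopologicalSpace.countableBasis Y
  have : Countable ι := (TopologicalSpace.countable_countableBasis Y).to_subtype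
  let : Encodable ι := Encodable.ofCountable ι
  -- A bump positive on `V` (when `V` is not everything) and zero off it. Its running supremum is
  -- monotone, and the cap at 1 makes the weighted series converge.
  let h : ι → Y → ℝ := fun V x => min 1 (Metric.infDist x (V : Set Y)ᶜ)
  have hc : ∀ V, Continuous (h V) := fun V => continuous_const.min (Metric.continuous_infDist_pt _)
  have h1 : ∀ V y, h V y ≤ 1 := fun V y => min_le_left _ _
  have h0 : ∀ V y, 0 ≤ h V y := fun V y => le_min zero_le_one Metric.infDist_nonneg
  let G : ι → Y → ℝ := fun V x => ⨆ y : Iic x, h V y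
  have : ∀ x : Y, Nonempty (Iic x) := fun x => ⟨⟨x, le_rfl⟩⟩
  have bdd : ∀ V (x : Y), BddAbove (range fun y : Iic x => h V y) := fun V x =>
    ⟨1, by rintro _ ⟨y, rfl⟩; exact h1 V y⟩
  have le : ∀ V {x y : Y}, y ≤ x → h V y ≤ G V x := fun V {x y} hyx =>
    le_ciSup (bdd V x) (⟨y, hyx⟩ : Iic x)
  have G1 : ∀ V x, G V x ≤ 1 := fun V x => ciSup_le fun y => h1 V y
  have G0 : ∀ V x, 0 ≤ G V x := fun V x => (h0 V x).trans (le V le_rfl)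
  have Gm : ∀ V, Monotone (G V) := fun V x y hxy =>
    ciSup_le fun z => le V ((show (z : Y) ≤ x from z.2).trans hxy)
  have Gc : ∀ V, Continuous (G V) := fun V => continuous_iSup_Iic (hc V) (h1 V)
  let w : ι → ℝ := fun V => (1 / 2) ^ Encodable.encode V
  have w0 : ∀ V, 0 < w V := fun V => by positivity
  have hw : Summable w := summable_geometric_two_encode
  have hs : ∀ x, Summable fun V => w V * G V x := fun x =>
    Summable.of_nonneg_of_le (fun V => mul_nonneg (w0 V).le (G0 V x))
      (fun V => mul_le_of_le_one_right (w0 V).le (G1 V x)) hw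
  refine ⟨fun x => ∑' V, w V * G V x, ?_, ?_⟩
  · intro x y hxy
    -- A basic `V` around `y` lying above `x` has running supremum zero at `x` and positive at `y`,
    -- so one term of the sum increases strictly.
    obtain ⟨V, hV, hyV, hVx⟩ := (TopologicalSpace.isBasis_countableBasis Y).exists_subset_of_mem_open
      (show y ∈ Ioi x from hxy) isOpen_Ioi
    have hGx : G ⟨V, hV⟩ x ≤ 0 := by
      refine ciSup_le fun z => ?_
      have : (z : Y) ∈ Vᶜ := fun hz => (show (z : Y) ≤ x from z.2).not_gt (hVx hz)
      simp [h, Metric.infDist_zero_of_mem this]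
    have hGy : 0 < G ⟨V, hV⟩ y := by
      refine lt_of_lt_of_le ?_ (le ⟨V, hV⟩ (le_refl y))
      refine lt_min one_pos ?_
      have hcl : IsClosed Vᶜ := ((TopologicalSpace.isBasis_countableBasis Y).isOpen hV).isClosed_compl
      exact (hcl.notMem_iff_infDist_pos ⟨x, fun hx => lt_irrefl _ (hVx hx)⟩).1 (by simpa using hyV)
    refine Summable.tsum_lt_tsum (i := ⟨V, hV⟩) (fun U => ?_) ?_ (hs x) (hs y)
    · exact mul_le_mul_of_nonneg_left (Gm U hxy.le) (w0 U).le
    · exact mul_lt_mul_of_pos_left (hGx.trans_lt hGy) (w0 _)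
  · refine continuous_tsum (fun V => continuous_const.mul (Gc V)) hw fun V x => ?_
    rw [Real.norm_of_nonneg (mul_nonneg (w0 V).le (G0 V x))]
    exact mul_le_of_le_one_right (w0 V).le (G1 V x)

end OrderEmbedding

theorem isEmbedding_div_const {δ : ℝ} (hδ : 0 < δ) : IsEmbedding fun t : ℝ => t / δ := by
  simpa [div_eq_mul_inv] using (Homeomorph.mulRight₀ δ⁻¹ (inv_ne_zero hδ.ne')).isEmbedding

/-! ### Charts with values in `[-1, 1]`. -/

section Charts

variable {X : Type*} [TopologicalSpace X]

/-- Order topologies are regular and Hausdorff, and `closure U` is a closed neighbourhood, so closed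
neighbourhoods in it remain closed neighbourhoods in X. -/
theorem RegularlyLocallyOrdered.t3Space (hX : RegularlyLocallyOrdered X) : T3Space X := by
  have hR : RegularSpace X := by
    refine RegularSpace.of_exists_mem_nhds_isClosed_subset fun x s hs => ?_
    obtain ⟨U, hU, _, _⟩ := hX x
    have hC : closure U ∈ 𝓝 x := mem_of_superset hU subset_closure
    have hs' : (Subtype.val : closure U → X) ⁻¹' s ∈ 𝓝 ⟨x, mem_of_mem_nhds hC⟩ :=
      continuous_subtype_val.continuousAt.preimage_mem_nhds hs
    obtain ⟨t, ht, htc, hts⟩ := exists_mem_nhds_isClosed_subset hs'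
    refine ⟨Subtype.val '' t, ?_, isClosed_closure.isClosedEmbedding_subtypeVal.isClosedMap t htc,
      image_subset_iff.2 hts⟩
    rw [← map_nhds_subtype_coe_eq_nhds (mem_of_mem_nhds hC) hC]
    exact image_mem_map ht
  have hT : T0Space X := by
    refine ⟨fun x y hxy => ?_⟩
    obtain ⟨U, hU, _, _⟩ := hX x
    have hy : U ∈ 𝓝 y := hxy.nhds_eq ▸ hU
    have h : Inseparable (⟨x, subset_closure (mem_of_mem_nhds hU)⟩ : closure U)
        ⟨y, subset_closure (mem_of_mem_nhds hy)⟩ := IsInducing.subtypeVal.inseparable_iff.1 hxy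
    exact congrArg Subtype.val h.eq
  exact {}

/-- `f` restricts to an embedding of the closed neighbourhood `C` of `q` into `[-1, 1]`, taking
`q` to `0`, such that only points with values `±1` can lie on the boundary of `C`. -/
structure IsChart (f : X → ℝ) (C : Set X) (q : X) : Prop where
  continuous : Continuous f
  isClosed : IsClosed C
  emb : IsEmbeddingOn f C
  mem : q ∈ C
  map_eq : f q = 0
  bound : ∀ x ∈ C, f x ∈ Icc (-1 : ℝ) 1
  isOpen : IsOpen (C ∩ f ⁻¹' Ioo (-1) 1)

namespace IsChart

variable {f : X → ℝ} {C : Set X} {q : X}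

theorem neg (h : IsChart f C q) : IsChart (fun x => -f x) C q where
  continuous := h.continuous.neg
  isClosed := h.isClosed
  emb := h.emb.comp (Homeomorph.neg ℝ).isEmbedding
  mem := h.mem
  map_eq := by simp [h.map_eq]
  bound x hx := by have := h.bound x hx; constructor <;> linarith [this.1, this.2]
  isOpen := by
    convert h.isOpen using 2
    ext x
    simp only [mem_preimage, mem_Ioo]
    constructor <;> intro h <;> constructor <;> linarith [h.1, h.2]

theorem isOpen_inter (h : IsChart f C q) {I : Set ℝ} (hI : IsOpen I) (hI' : I ⊆ Ioo (-1) 1) :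
    IsOpen (C ∩ f ⁻¹' I) := by
  have : C ∩ f ⁻¹' I = (C ∩ f ⁻¹' Ioo (-1) 1) ∩ f ⁻¹' I := by
    rw [inter_assoc, ← preimage_inter, inter_eq_right.2 hI']
  rw [this]
  exact h.isOpen.inter (hI.preimage h.continuous)

theorem isClosed_inter (h : IsChart f C q) {I : Set ℝ} (hI : IsClosed I) :
    IsClosed (C ∩ f ⁻¹' I) := h.isClosed.inter (hI.preimage h.continuous)

theorem inter_mem_nhds (h : IsChart f C q) {δ : ℝ} (hδ : 0 < δ) (hδ1 : δ ≤ 1) :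
    C ∩ f ⁻¹' Ioo (-δ) δ ∈ 𝓝 q := by
  refine (h.isOpen_inter isOpen_Ioo (Ioo_subset_Ioo (by linarith) hδ1)).mem_nhds ⟨h.mem, ?_⟩
  rw [mem_preimage, h.map_eq]
  exact ⟨by linarith, hδ⟩

/-- Zooming in on the centre of a chart. -/
theorem rescale (h : IsChart f C q) {δ : ℝ} (hδ : 0 < δ) (hδ1 : δ ≤ 1) :
    IsChart (fun x => f x / δ) (C ∩ f ⁻¹' Icc (-δ) δ) q where
  continuous := h.continuous.div_const δ
  isClosed := h.isClosed_inter isClosed_Icc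
  emb := (h.emb.mono inter_subset_left).comp (k := fun t => t / δ)
    (isEmbedding_div_const hδ)
  mem := ⟨h.mem, by rw [mem_preimage, h.map_eq]; constructor <;> linarith⟩
  map_eq := by simp [h.map_eq]
  bound x hx := by
    have := hx.2
    rw [mem_preimage, mem_Icc] at this
    rw [mem_Icc, le_div_iff₀ hδ, div_le_iff₀ hδ]
    constructor <;> linarith [this.1, this.2]
  isOpen := by
    convert h.isOpen_inter (I := Ioo (-δ) δ) isOpen_Ioo (Ioo_subset_Ioo (by linarith) hδ1) using 1
    ext x
    simp only [mem_inter_iff, mem_preimage, mem_Ioo, mem_Icc, lt_div_iff₀ hδ, div_lt_iff₀ hδ]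
    constructor
    · rintro ⟨⟨hx, _⟩, h1, h2⟩
      exact ⟨hx, by linarith, by linarith⟩
    · rintro ⟨hx, h1, h2⟩
      exact ⟨⟨hx, h1.le, h2.le⟩, by linarith, by linarith⟩

end IsChart

theorem OrderableSpace.exists_isEmbedding [SecondCountableTopology X] (h : OrderableSpace X) :
    ∃ g : X → ℝ, IsEmbedding g := by
  obtain ⟨_, _⟩ := h
  obtain ⟨g, hm, hc⟩ := exists_strictMono_continuous (Y := X)
  exact ⟨g, isEmbedding_of_strictMono hm hc⟩

/-- In a second-countable regularly locally ordered space, charts form neighbourhood bases. -/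
theorem RegularlyLocallyOrdered.exists_isChart [SecondCountableTopology X]
    (hX : RegularlyLocallyOrdered X) (q : X) {N : Set X} (hN : N ∈ 𝓝 q) :
    ∃ f C, IsChart f C q ∧ C ⊆ N := by
  have := hX.t3Space
  obtain ⟨U, hU, hord⟩ := hX q
  obtain ⟨g, hg⟩ := hord.exists_isEmbedding
  -- Tietze extension; X is normal, being T3 and second countable.
  obtain ⟨f₀, hf₀⟩ := ContinuousMap.exists_restrict_eq isClosed_closure (⟨g, hg.continuous⟩ : C(_, ℝ))
  have hq : q ∈ closure U := subset_closure (mem_of_mem_nhds hU)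
  have he₀ : IsEmbeddingOn f₀ (closure U) := by
    rw [isEmbeddingOn_iff]
    convert hg
    exact congrArg DFunLike.coe hf₀
  -- Landing in the interior of `U`, and not just in `N`, makes the open window of radius `ε / 2`
  -- open in X.
  obtain ⟨ε, hε, hεN⟩ := he₀.exists_pos hq (inter_mem hN (interior_mem_nhds.2 hU))
  refine ⟨fun x => (f₀ x - f₀ q) / (ε / 2), closure U ∩ {x | |f₀ x - f₀ q| ≤ ε / 2}, ?_, ?_⟩
  · have hδ : 0 < ε / 2 := by positivity
    refine ⟨?_, ?_, ?_, ?_, ?_, ?_, ?_⟩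
    · fun_prop
    · exact isClosed_closure.inter (isClosed_le (by fun_prop) continuous_const)
    · exact (he₀.mono inter_subset_left).comp (k := fun t => (t - f₀ q) / (ε / 2))
        ((isEmbedding_div_const hδ).comp (Homeomorph.subRight (f₀ q)).isEmbedding)
    · exact ⟨hq, by simpa using hδ.le⟩
    · simp
    · rintro x ⟨_, hx⟩
      rw [mem_ofPred_eq, abs_le] at hx
      rw [mem_Icc, le_div_iff₀ hδ, div_le_iff₀ hδ]
      constructor <;> linarith [hx.1, hx.2]
    · convert isOpen_interior (s := U) |>.inter
        (isOpen_lt (f := fun x => |f₀ x - f₀ q|) (g := fun _ => ε / 2) (by fun_prop)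
          continuous_const) using 1
      ext x
      simp only [mem_inter_iff, mem_preimage, mem_Ioo, mem_ofPred_eq, lt_div_iff₀ hδ,
        div_lt_iff₀ hδ]
      constructor
      · rintro ⟨⟨hx, _⟩, h1, h2⟩
        have h3 : |f₀ x - f₀ q| < ε / 2 := by rw [abs_lt]; constructor <;> linarith
        exact ⟨(hεN x hx (h3.trans (by linarith))).2, h3⟩
      · rintro ⟨hx, h1⟩
        rw [abs_lt] at h1
        refine ⟨⟨subset_closure (interior_subset hx), ?_⟩, by linarith [h1.1], by linarith [h1.2]⟩
        rw [abs_le]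
        exact ⟨h1.1.le, h1.2.le⟩
  · rintro x ⟨hx, hx2⟩
    exact (hεN x hx (lt_of_le_of_lt hx2 (by linarith))).1

end Charts

/-! ### Ends of arcs, and closing an arc up to a circle. -/

section Ends

variable {X : Type*} [TopologicalSpace X]

theorem mapClusterPt_neg_iff {e : ℝ → X} {q : X} :
    MapClusterPt q atTop (fun t => e (-t)) ↔ MapClusterPt q atBot e := by
  rw [MapClusterPt, MapClusterPt, ← map_neg_atTop, Filter.map_map]
  rfl

namespace IsChart

variable {f : X → ℝ} {C : Set X} {q : X} {e : ℝ → X}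

/-- By injectivity the path meets each boundary value `±1` within `C` at most once. Afterwards the
connected ray is covered by two disjoint open sets, the inner part of the chart and the complement
of `C`, and clustering at `q` selects the former. -/
theorem eventually_mem (h : IsChart f C q) (he : Continuous e) (hi : Function.Injective e)
    (hq : MapClusterPt q atTop e) :
    ∀ᶠ t in atTop, e t ∈ C ∩ f ⁻¹' Ioo (-1) 1 := by
  have key : ∀ c : ℝ, ∀ᶠ t in atTop, ¬ (e t ∈ C ∧ f (e t) = c) := by
    intro c
    by_cases hc : ∃ t₀, e t₀ ∈ C ∧ f (e t₀) = c
    · obtain ⟨t₀, h₀, h₀'⟩ := hc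
      filter_upwards [eventually_gt_atTop t₀] with t ht ⟨h1, h2⟩
      exact ht.ne (hi (h.emb.1 h₀ h1 (h₀'.trans h2.symm)))
    · exact Eventually.of_forall fun t ht => hc ⟨t, ht⟩
  obtain ⟨T, hT⟩ := eventually_atTop.1 ((key 1).and (key (-1)))
  have hcov : Ici T ⊆ e ⁻¹' (C ∩ f ⁻¹' Ioo (-1) 1) ∪ e ⁻¹' Cᶜ := by
    intro t ht
    by_cases hC : e t ∈ C
    · refine Or.inl ⟨hC, ?_⟩
      have hb := h.bound _ hC
      exact ⟨lt_of_le_of_ne hb.1 fun h' => (hT t ht).2 ⟨hC, h'.symm⟩,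
        lt_of_le_of_ne hb.2 fun h' => (hT t ht).1 ⟨hC, h'⟩⟩
    · exact Or.inr hC
  have hne : (Ici T ∩ e ⁻¹' (C ∩ f ⁻¹' Ioo (-1) 1)).Nonempty := by
    obtain ⟨t, ht, ht'⟩ := ((hq.frequently (h.inter_mem_nhds one_pos le_rfl)).and_eventually
      (eventually_ge_atTop T)).exists
    exact ⟨t, ht', ht⟩
  have := isPreconnected_Ici.subset_left_of_subset_union (h.isOpen.preimage he)
    (h.isClosed.isOpen_compl.preimage he)
    (disjoint_left.2 fun t ht ht' => ht' ht.1) hcov hne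
  filter_upwards [eventually_ge_atTop T] with t ht using this ht

/-- An increasing function with cluster value `f q = 0` stays below 0 and comes arbitrarily close to
it. Intermediate values fill the interval, and injectivity of `f` on `C` leaves no other chart
points over it. -/
theorem image_Ici_eq (h : IsChart f C q) (he : Continuous e)
    (hq : MapClusterPt q atTop e) {T : ℝ} (hT : ∀ t ≥ T, e t ∈ C)
    (hm : StrictMonoOn (f ∘ e) (Ici T)) :
    f (e T) < 0 ∧ e '' Ici T = C ∩ f ⁻¹' Ico (f (e T)) 0 ∧ Ico (f (e T)) 0 ⊆ f '' C := by
  have hfq : MapClusterPt (0 : ℝ) atTop (f ∘ e) := by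
    rw [← h.map_eq]
    exact hq.continuousAt_comp h.continuous.continuousAt
  have hneg : ∀ t ≥ T, f (e t) < 0 := by
    intro t ht
    by_contra! hc
    have h1 : f (e t) < f (e (t + 1)) := hm ht (by simp; linarith) (by linarith)
    obtain ⟨s, hs, hs'⟩ := ((hfq.frequently (Iio_mem_nhds (hc.trans_lt h1))).and_eventually
      (eventually_ge_atTop (t + 1))).exists
    have h2 : f (e (t + 1)) ≤ f (e s) :=
      hm.monotoneOn (by simp; linarith) (by simp; linarith) hs'
    exact absurd hs h2.not_gt
  have hsurj : ∀ y ∈ Ico (f (e T)) 0, ∃ t ≥ T, f (e t) = y := by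
    intro y hy
    obtain ⟨s, hs, hs'⟩ := ((hfq.frequently (Ioi_mem_nhds hy.2)).and_eventually
      (eventually_ge_atTop T)).exists
    obtain ⟨t, ht, hty⟩ := intermediate_value_Icc hs' (h.continuous.comp he).continuousOn
      (⟨hy.1, le_of_lt hs⟩ : y ∈ Icc ((f ∘ e) T) ((f ∘ e) s))
    exact ⟨t, ht.1, hty⟩
  refine ⟨hneg T le_rfl, ?_, ?_⟩
  · ext x
    constructor
    · rintro ⟨t, ht, rfl⟩
      exact ⟨hT t ht, hm.monotoneOn self_mem_Ici ht ht, hneg t ht⟩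
    · rintro ⟨hxC, hx⟩
      obtain ⟨t, ht, hty⟩ := hsurj _ hx
      exact ⟨t, ht, h.emb.1 (hT t ht) hxC hty⟩
  · intro y hy
    obtain ⟨t, ht, hty⟩ := hsurj _ hy
    exact ⟨e t, hT t ht, hty⟩

/-- An injective path clustering at the centre of a chart eventually moves monotonically in it. -/
theorem exists_strictMonoOn (h : IsChart f C q) (he : Continuous e) (hi : Function.Injective e)
    (hq : MapClusterPt q atTop e) (T₀ : ℝ) :
    ∃ T ≥ T₀, (∀ t ≥ T, e t ∈ C) ∧
      (StrictMonoOn (f ∘ e) (Ici T) ∨ StrictMonoOn ((fun x => -f x) ∘ e) (Ici T)) := by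
  obtain ⟨T, hT, hT₀⟩ := ((eventually_forall_ge_atTop.2 (h.eventually_mem he hi hq)).and
    (eventually_ge_atTop T₀)).exists
  -- The exponential turns the open ray beyond `T` into the whole line, where an injective
  -- continuous function is strictly monotone or antitone.
  have hcont : Continuous fun t => f (e (T + Real.exp t)) :=
    h.continuous.comp (he.comp (continuous_const.add Real.continuous_exp))
  have hinj : Function.Injective fun t => f (e (T + Real.exp t)) := by
    intro s t hst
    have hs := hT (T + Real.exp s) (by linarith [Real.exp_pos s])
    have ht := hT (T + Real.exp t) (by linarith [Real.exp_pos t])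
    exact Real.exp_injective (add_left_cancel (hi (h.emb.1 hs.1 ht.1 hst)))
  have hrw : ∀ t, T + 1 ≤ t → t = T + Real.exp (Real.log (t - T)) := fun t ht => by
    rw [Real.exp_log (by linarith)]; ring
  have hlog : ∀ s t, T + 1 ≤ s → s < t → Real.log (s - T) < Real.log (t - T) :=
    fun s t hs hst => Real.log_lt_log (by linarith) (by linarith)
  refine ⟨T + 1, by linarith, fun t ht => (hT t (by linarith)).1, ?_⟩
  refine (hcont.strictMono_of_inj hinj).imp (fun hm => ?_) (fun hm => ?_)
  · intro s hs t ht hst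
    rw [hrw s hs, hrw t ht]
    exact hm (hlog s t hs hst)
  · intro s hs t ht hst
    rw [hrw s hs, hrw t ht]
    exact neg_lt_neg (hm (hlog s t hs hst))

/-- An injective path clustering at the centre of a chart eventually traces out one side of it. -/
theorem exists_image_Ici_eq (h : IsChart f C q) (he : Continuous e) (hi : Function.Injective e)
    (hq : MapClusterPt q atTop e) (T₀ : ℝ) :
    ∃ T ≥ T₀, ∃ δ ∈ Ioc (0 : ℝ) 1,
      (e '' Ici T = C ∩ f ⁻¹' Ico (-δ) 0 ∧ Ico (-δ) 0 ⊆ f '' C) ∨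
      (e '' Ici T = C ∩ f ⁻¹' Ioc 0 δ ∧ Ioc 0 δ ⊆ f '' C) := by
  obtain ⟨T, hT₀, hTC, hm⟩ := h.exists_strictMonoOn he hi hq T₀
  have hb := h.bound _ (hTC _ le_rfl)
  refine ⟨T, hT₀, ?_⟩
  rcases hm with hm | hm
  · obtain ⟨h1, h2, h3⟩ := h.image_Ici_eq he hq hTC hm
    refine ⟨-f (e T), ⟨by linarith, by linarith [hb.1]⟩, Or.inl ?_⟩
    rw [neg_neg]
    exact ⟨h2, h3⟩
  · obtain ⟨h1, h2, h3⟩ := h.neg.image_Ici_eq he hq hTC hm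
    refine ⟨f (e T), ⟨by linarith, hb.2⟩, Or.inr ⟨?_, ?_⟩⟩
    · rw [h2]
      ext x
      simp only [mem_inter_iff, mem_preimage, mem_Ico, mem_Ioc]
      constructor <;> rintro ⟨hx, h4, h5⟩ <;> exact ⟨hx, by linarith, by linarith⟩
    · intro y hy
      obtain ⟨x, hx, hxy⟩ := h3 (show -y ∈ Ico (-f (e T)) 0 from
        ⟨by linarith [hy.2], by linarith [hy.1]⟩)
      exact ⟨x, hx, neg_injective hxy⟩

end IsChart

/-- Charts are arbitrarily small, and each eventually traps the path. -/
theorem tendsto_of_mapClusterPt {e : ℝ → X} {q : X}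
    (hX : ∀ N ∈ 𝓝 q, ∃ f C, IsChart f C q ∧ C ⊆ N) (he : Continuous e)
    (hi : Function.Injective e) (hq : MapClusterPt q atTop e) : Tendsto e atTop (𝓝 q) := by
  intro N hN
  obtain ⟨f, C, h, hC⟩ := hX N hN
  filter_upwards [h.eventually_mem he hi hq] with t ht using hC ht.1

theorem notMem_range_of_mapClusterPt {e : ℝ → X} {q : X} (he : IsOpenEmbedding e)
    (hq : MapClusterPt q atTop e) : q ∉ range e := by
  rintro ⟨s, rfl⟩
  obtain ⟨t, ⟨u, hu, hut⟩, ht⟩ := ((hq.frequently 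
    (he.image_mem_nhds.2 (Iio_mem_nhds (lt_add_one s)))).and_eventually
    (eventually_ge_atTop (s + 1))).exists
  rw [he.injective hut] at hu
  exact absurd hu (not_lt.2 ht)

/-- Any initial segment of the ray has compact, hence closed, image, so a new closure point is
approached only at late times. -/
theorem mapClusterPt_of_mem_closure_image_Ici [T2Space X] {e : ℝ → X} {q : X} (he : Continuous e)
    {T : ℝ} (hq : q ∈ closure (e '' Ici T)) (hqe : q ∉ e '' Ici T) : MapClusterPt q atTop e := by
  rw [mapClusterPt_iff_frequently]
  intro N hN
  rw [frequently_atTop]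
  intro T'
  by_contra! hc
  have hsub : e '' Ici T ⊆ e '' Icc T T' ∪ Nᶜ := by
    rintro _ ⟨t, ht, rfl⟩
    rcases le_total t T' with h | h
    · exact Or.inl ⟨t, ⟨ht, h⟩, rfl⟩
    · exact Or.inr (hc t h)
  have h1 := closure_mono hsub hq
  rw [closure_union, (isCompact_Icc.image he).isClosed.closure_eq] at h1
  rcases h1 with ⟨t, ht, rfl⟩ | h1
  · exact hqe ⟨t, ht.1, rfl⟩
  · rw [closure_compl] at h1
    exact h1 (mem_interior_iff_mem_nhds.2 hN)

theorem mapClusterPt_of_mem_closure_image_Iic [T2Space X] {e : ℝ → X} {q : X} (he : Continuous e)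
    {T : ℝ} (hq : q ∈ closure (e '' Iic T)) (hqe : q ∉ e '' Iic T) : MapClusterPt q atBot e := by
  have h : e '' Iic T = (fun t => e (-t)) '' Ici (-T) := by
    rw [← image_image (g := e) (f := fun t => -t)]
    simp
  rw [← mapClusterPt_neg_iff]
  rw [h] at hq hqe
  exact mapClusterPt_of_mem_closure_image_Ici (he.comp continuous_neg) hq hqe

theorem nonempty_onePoint_real_homeomorph_circle : Nonempty (OnePoint ℝ ≃ₜ Circle) := by
  have h : OnePoint ℝ ≃ₜ Metric.sphere (0 : EuclideanSpace ℝ (Fin 2)) 1 :=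
    onePointEquivSphereOfFinrankEq (by simp)
  let i := Complex.orthonormalBasisOneI.repr
  refine ⟨h.trans (Homeomorph.subtype i.toHomeomorph.symm fun x => ?_)⟩
  have : ‖i.symm x‖ = ‖x‖ := i.symm.norm_map x
  change x ∈ Metric.sphere 0 1 ↔ i.symm x ∈ Metric.sphere 0 1
  rw [mem_sphere_zero_iff_norm, mem_sphere_zero_iff_norm, this]

/-- An open arc whose two ends converge to the same point closes up to a clopen circle. -/
theorem isClopen_insert_range [T2Space X] {e : ℝ → X} {q : X}
    (hX : ∀ N ∈ 𝓝 q, ∃ f C, IsChart f C q ∧ C ⊆ N) (he : IsOpenEmbedding e)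
    (hq : MapClusterPt q atTop e) (hq' : MapClusterPt q atBot e) :
    IsClopen (insert q (range e)) ∧ Nonempty (↥(insert q (range e) : Set X) ≃ₜ Circle) := by
  have hqe := notMem_range_of_mapClusterPt he hq
  have hc' : Continuous fun t => e (-t) := he.continuous.comp continuous_neg
  have hi' : Function.Injective fun t => e (-t) := he.injective.comp neg_injective
  have hq'' := mapClusterPt_neg_iff.2 hq'
  have ht := tendsto_of_mapClusterPt hX he.continuous he.injective hq
  have ht' : Tendsto e atBot (𝓝 q) := by
    have := (tendsto_of_mapClusterPt hX hc' hi' hq'').comp tendsto_neg_atBot_atTop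
    simpa [Function.comp_def] using this
  let F : OnePoint ℝ → X := fun z => z.elim q e
  have hF : Continuous F := by
    rw [OnePoint.continuous_iff]
    refine ⟨?_, he.continuous⟩
    rw [coclosedCompact_eq_cocompact, cocompact_eq_atBot_atTop]
    exact ht'.sup ht
  have hFi : Function.Injective F := by
    intro x y hxy
    induction x using OnePoint.rec <;> induction y using OnePoint.rec
    · rfl
    · exact absurd ⟨_, hxy.symm⟩ hqe
    · exact absurd ⟨_, hxy⟩ hqe
    · exact congrArg _ (he.injective hxy)
  have hFr : range F = insert q (range e) := by
    ext x
    constructor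
    · rintro ⟨z, rfl⟩
      induction z using OnePoint.rec with
      | infty => exact Or.inl rfl
      | coe t => exact Or.inr ⟨t, rfl⟩
    · rintro (rfl | ⟨t, rfl⟩)
      · exact ⟨OnePoint.infty, rfl⟩
      · exact ⟨(t : OnePoint ℝ), rfl⟩
  have hFe := hF.isClosedEmbedding hFi
  refine ⟨⟨hFr ▸ hFe.isClosed_range, ?_⟩, ?_⟩
  · rw [isOpen_iff_mem_nhds]
    rintro x (rfl | hx)
    swap
    · exact mem_of_superset (he.isOpen_range.mem_nhds hx) (subset_insert _ _)
    obtain ⟨f, C, h, -⟩ := hX univ univ_mem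
    -- The bound 1 for both tails keeps them disjoint. Each fills one side of `q`, and a shared side
    -- would give a common point, so together they cover both sides.
    obtain ⟨T, hT, δ, hδ, H⟩ := h.exists_image_Ici_eq he.continuous he.injective hq 1
    obtain ⟨T', hT', δ', hδ', H'⟩ := h.exists_image_Ici_eq hc' hi' hq'' 1
    have hm : 0 < min δ δ' := lt_min hδ.1 hδ'.1
    have hdisj : ∀ x ∈ e '' Ici T, x ∉ (fun t => e (-t)) '' Ici T' := by
      rintro _ ⟨t, ht, rfl⟩ ⟨s, hs, hst⟩
      have := he.injective hst
      rw [mem_Ici] at ht hs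
      linarith
    refine mem_of_superset (h.inter_mem_nhds hm ((min_le_left _ _).trans hδ.2)) ?_
    rintro x ⟨hxC, hx⟩
    have hx1 : f x < δ := hx.2.trans_le (min_le_left _ _)
    have hx2 : f x < δ' := hx.2.trans_le (min_le_right _ _)
    have hx3 : -δ < f x := (neg_le_neg (min_le_left _ _)).trans_lt hx.1
    have hx4 : -δ' < f x := (neg_le_neg (min_le_right _ _)).trans_lt hx.1
    have key : ∀ x, x ∈ e '' Ici T ∨ x ∈ (fun t => e (-t)) '' Ici T' → x ∈ range e := by
      rintro x (⟨t, _, rfl⟩ | ⟨t, _, rfl⟩) <;> exact mem_range_self _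
    rcases lt_trichotomy (f x) 0 with h0 | h0 | h0
    · refine Or.inr (key x ?_)
      rcases H with ⟨H, _⟩ | ⟨H, HS⟩
      · rw [H]; exact Or.inl ⟨hxC, hx3.le, h0⟩
      · rcases H' with ⟨H', _⟩ | ⟨H', _⟩
        · rw [H']; exact Or.inr ⟨hxC, hx4.le, h0⟩
        · exfalso
          obtain ⟨y, hy, hfy⟩ := HS ⟨hm, min_le_left δ δ'⟩
          refine hdisj y ?_ ?_
          · rw [H]; exact ⟨hy, by rw [mem_preimage, hfy]; exact ⟨hm, min_le_left _ _⟩⟩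
          · rw [H']; exact ⟨hy, by rw [mem_preimage, hfy]; exact ⟨hm, min_le_right _ _⟩⟩
    · exact Or.inl (h.emb.1 hxC h.mem (h0.trans h.map_eq.symm))
    · refine Or.inr (key x ?_)
      rcases H with ⟨H, HS⟩ | ⟨H, _⟩
      · rcases H' with ⟨H', _⟩ | ⟨H', _⟩
        · exfalso
          have hm1 : -min δ δ' ∈ Ico (-δ) 0 :=
            ⟨neg_le_neg (min_le_left _ _), by linarith⟩
          have hm2 : -min δ δ' ∈ Ico (-δ') 0 :=
            ⟨neg_le_neg (min_le_right _ _), by linarith⟩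
          obtain ⟨y, hy, hfy⟩ := HS hm1
          refine hdisj y ?_ ?_
          · rw [H]; exact ⟨hy, by rw [mem_preimage, hfy]; exact hm1⟩
          · rw [H']; exact ⟨hy, by rw [mem_preimage, hfy]; exact hm2⟩
        · rw [H']; exact Or.inr ⟨hxC, h0, hx2.le⟩
      · rw [H]; exact Or.inl ⟨hxC, h0, hx1.le⟩
  · obtain ⟨c⟩ := nonempty_onePoint_real_homeomorph_circle
    exact ⟨(Homeomorph.setCongr hFr.symm).trans (hFe.isEmbedding.toHomeomorph.symm.trans c)⟩

end Ends

/-! ### Open arcs and maximal arcs. -/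

section Arcs

variable {X : Type*} [TopologicalSpace X]

/-- An open subset homeomorphic to the real line. -/
def IsOpenArc (V : Set X) : Prop := ∃ e : ℝ → X, IsOpenEmbedding e ∧ range e = V

theorem exists_isOpenEmbedding_range_eq_Ioo {a b : ℝ} (hab : a < b) :
    ∃ k : ℝ → ℝ, IsOpenEmbedding k ∧ range k = Ioo a b := by
  let k₀ : ℝ → ℝ := fun t => (Real.tanOrderIso.symm t : ℝ)
  have hk₀ : IsOpenEmbedding k₀ :=
    isOpen_Ioo.isOpenEmbedding_subtypeVal.comp Real.tanOrderIso.symm.toHomeomorph.isOpenEmbedding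
  have hr₀ : range k₀ = Ioo (-(Real.pi / 2)) (Real.pi / 2) := by
    change range (Subtype.val ∘ Real.tanOrderIso.symm) = _
    rw [range_comp, Real.tanOrderIso.symm.surjective.range_eq, image_univ, Subtype.range_val]
  have hc : 0 < (b - a) / Real.pi := div_pos (sub_pos.2 hab) Real.pi_pos
  let l : ℝ ≃ₜ ℝ := (Homeomorph.mulLeft₀ _ hc.ne').trans (Homeomorph.addRight ((a + b) / 2))
  refine ⟨l ∘ k₀, l.isOpenEmbedding.comp hk₀, ?_⟩
  rw [range_comp, hr₀]
  change (fun x => (b - a) / Real.pi * x + (a + b) / 2) '' _ = _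
  rw [image_affine_Ioo hc]
  have := Real.pi_pos.ne'
  congr 1 <;> field_simp <;> ring

/-- A nonempty open connected subset of ℝ, once compressed into `(0, 1)`, is the open interval
between its infimum and supremum, and that is a copy of ℝ. -/
theorem isOpenArc_of_isEmbedding {W : Set X} (hW : IsOpen W) {g : W → ℝ} (hg : IsEmbedding g)
    (ho : IsOpen (range g)) (hc : IsPreconnected (range g)) (hne : W.Nonempty) :
    IsOpenArc W := by
  obtain ⟨k, hk, hkr⟩ := exists_isOpenEmbedding_range_eq_Ioo zero_lt_one
  let J := range (k ∘ g)
  have hJe : J = k '' range g := range_comp k g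
  have hJo : IsOpen J := hJe ▸ hk.isOpenMap _ ho
  have hJc : IsPreconnected J := hJe ▸ hc.image k hk.continuous.continuousOn
  have hJs : J ⊆ Ioo 0 1 := by
    rw [← hkr, hJe]
    exact image_subset_range _ _
  have hJb : BddBelow J := ⟨0, fun x hx => (hJs hx).1.le⟩
  have hJa : BddAbove J := ⟨1, fun x hx => (hJs hx).2.le⟩
  obtain ⟨x₀, hx₀'⟩ := hne
  have hx₀ : k (g ⟨x₀, hx₀'⟩) ∈ J := ⟨⟨x₀, hx₀'⟩, rfl⟩
  have hJ : J = Ioo (sInf J) (sSup J) := by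
    refine Subset.antisymm (fun x hx => ?_) (IsConnected.Ioo_csInf_csSup_subset ⟨⟨_, hx₀⟩, hJc⟩ hJb hJa)
    obtain ⟨ε, hε, hball⟩ := Metric.isOpen_iff.1 hJo x hx
    have h1 : x - ε / 2 ∈ J := hball (by simp [abs_of_pos hε, hε])
    have h2 : x + ε / 2 ∈ J := hball (by simp [abs_of_pos hε, hε])
    exact ⟨(csInf_le hJb h1).trans_lt (by linarith), lt_of_lt_of_le (by linarith) (le_csSup hJa h2)⟩
  have hlt : sInf J < sSup J := by
    rw [hJ] at hx₀
    exact hx₀.1.trans hx₀.2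
  obtain ⟨l, hl, hlr⟩ := exists_isOpenEmbedding_range_eq_Ioo hlt
  let φ : ℝ ≃ₜ W := hl.isEmbedding.toHomeomorph.trans
    ((Homeomorph.setCongr (hlr.trans hJ.symm)).trans (hk.isEmbedding.comp hg).toHomeomorph.symm)
  refine ⟨Subtype.val ∘ φ, hW.isOpenEmbedding_subtypeVal.comp φ.isOpenEmbedding, ?_⟩
  rw [range_comp, φ.surjective.range_eq, image_univ, Subtype.range_val]

/-- A union of compatibly oriented nested open arcs is an open arc. -/
theorem isOpenArc_iUnion [SecondCountableTopology X] {ι : Type*} [Nonempty ι] {e : ι → ℝ → X}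
    (he : ∀ i, IsOpenEmbedding (e i))
    (H : ∀ i j, (∃ φ : ℝ → ℝ, StrictMono φ ∧ e i = e j ∘ φ) ∨
      ∃ φ : ℝ → ℝ, StrictMono φ ∧ e j = e i ∘ φ) :
    IsOpenArc (⋃ i, range (e i)) := by
  let U := ⋃ i, range (e i)
  have hUo : IsOpen U := isOpen_iUnion fun i => (he i).isOpen_range
  have key : ∀ {i j s t s' t'}, e i s = e j s' → e i t = e j t' → s ≤ t → s' ≤ t' := by
    intro i j s t s' t' hs ht hst
    rcases H i j with ⟨φ, hφ, h⟩ | ⟨φ, hφ, h⟩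
    · rw [h] at hs ht
      rw [← (he j).injective hs, ← (he j).injective ht]
      exact hφ.monotone hst
    · rw [h] at hs ht
      rw [(he i).injective hs, (he i).injective ht] at hst
      exact hφ.le_iff_le.1 hst
  have hnest : ∀ i j, range (e i) ⊆ range (e j) ∨ range (e j) ⊆ range (e i) := by
    intro i j
    rcases H i j with ⟨φ, -, h⟩ | ⟨φ, -, h⟩
    · exact Or.inl (h ▸ range_comp_subset_range _ _)
    · exact Or.inr (h ▸ range_comp_subset_range _ _)
  have two : ∀ x ∈ U, ∀ i, ∃ k, range (e i) ⊆ range (e k) ∧ x ∈ range (e k) := by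
    intro x hx i
    obtain ⟨j, hj⟩ := mem_iUnion.1 hx
    rcases hnest i j with h | h
    · exact ⟨j, h, hj⟩
    · exact ⟨i, subset_rfl, h hj⟩
  have pair : ∀ x y : U, ∃ k s t, e k s = x ∧ e k t = y := by
    intro x y
    obtain ⟨i, hi⟩ := mem_iUnion.1 x.2
    obtain ⟨k, hk, t, ht⟩ := two y y.2 i
    obtain ⟨s, hs⟩ := hk hi
    exact ⟨k, s, t, hs, ht⟩
  -- Any two points lie on a common arc, and by `key` their order there does not depend on the arc.
  -- The topology of `U` turns out to be the order topology, so `U` embeds in ℝ with open,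
  -- order-connected image.
  let le : U → U → Prop := fun x y => ∃ i s t, e i s = x ∧ e i t = y ∧ s ≤ t
  have le_iff : ∀ {x y : U} {i s t}, e i s = x → e i t = y → (le x y ↔ s ≤ t) := by
    intro x y i s t hs ht
    constructor
    · rintro ⟨j, s', t', hs', ht', h⟩
      exact key (hs'.trans hs.symm) (ht'.trans ht.symm) h
    · exact fun h => ⟨i, s, t, hs, ht, h⟩
  let inst : LinearOrder U :=
    { le := le
      le_refl := fun x => by
        obtain ⟨k, s, t, hs, -⟩ := pair x x
        exact (le_iff hs hs).2 le_rfl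
      le_trans := fun x y z hxy hyz => by
        obtain ⟨i, s, t, hs, ht⟩ := pair x y
        obtain ⟨k, hk, u, hu⟩ := two z z.2 i
        obtain ⟨s', hs'⟩ := hk ⟨s, hs⟩
        obtain ⟨t', ht'⟩ := hk ⟨t, ht⟩
        exact (le_iff hs' hu).2 (((le_iff hs' ht').1 hxy).trans ((le_iff ht' hu).1 hyz))
      le_antisymm := fun x y hxy hyx => by
        obtain ⟨i, s, t, hs, ht⟩ := pair x y
        have := le_antisymm ((le_iff hs ht).1 hxy) ((le_iff ht hs).1 hyx)
        exact Subtype.ext (by rw [← hs, ← ht, this])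
      le_total := fun x y => by
        obtain ⟨i, s, t, hs, ht⟩ := pair x y
        exact (le_total s t).imp (le_iff hs ht).2 (le_iff ht hs).2
      toDecidableLE := Classical.decRel _ }
  have lt_iff : ∀ {x y : U} {i s t}, e i s = x → e i t = y → (x < y ↔ s < t) := by
    intro x y i s t hs ht
    rw [← not_le, ← not_le]
    exact not_congr (le_iff ht hs)
  have mem : ∀ i s, e i s ∈ U := fun i s => mem_iUnion.2 ⟨i, s, rfl⟩
  -- Each arc is order-convex in the union, by intermediate values of the transition map.
  have between : ∀ (i s t) (y : U), (⟨e i s, mem i s⟩ : U) < y → y < ⟨e i t, mem i t⟩ →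
      ∃ u ∈ Ioo s t, e i u = y := by
    intro i s t y h1 h2
    suffices h : ∃ u, e i u = y by
      obtain ⟨u, hu⟩ := h
      exact ⟨u, ⟨(lt_iff rfl hu).1 h1, (lt_iff hu rfl).1 h2⟩, hu⟩
    obtain ⟨j, u, hu⟩ := mem_iUnion.1 y.2
    rcases H i j with ⟨φ, hφ, h⟩ | ⟨φ, hφ, h⟩
    · have hφc : Continuous φ := (he j).isInducing.continuous_iff.2 (h ▸ (he i).continuous)
      have h1' := (lt_iff (x := ⟨e i s, mem i s⟩) (i := j) (s := φ s) (congrFun h s).symm hu).1 h1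
      have h2' := (lt_iff (y := ⟨e i t, mem i t⟩) (i := j) (t := φ t) hu (congrFun h t).symm).1 h2
      obtain ⟨v, -, hv⟩ := intermediate_value_Icc (hφ.lt_iff_lt.1 (h1'.trans h2')).le
        hφc.continuousOn ⟨h1'.le, h2'.le⟩
      exact ⟨v, by rw [h, ← hu, ← hv]; rfl⟩
    · exact ⟨φ u, by rw [← hu, h]; rfl⟩
  have hot : OrderTopology U := by
    refine ⟨le_antisymm (le_generateFrom ?_) ?_⟩
    · have himg : ∀ (i) (s : Set ℝ), IsOpen s → IsOpen (Subtype.val ⁻¹' (e i '' s) : Set U) :=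
        fun i s hs => ((he i).isOpenMap s hs).preimage continuous_subtype_val
      rintro _ ⟨a, rfl | rfl⟩
      · rw [isOpen_iff_forall_mem_open]
        intro x hx
        obtain ⟨i, s, t, hs, ht⟩ := pair a x
        refine ⟨Subtype.val ⁻¹' (e i '' Ioi s), ?_, himg i _ isOpen_Ioi, ⟨t, (lt_iff hs ht).1 hx, ht⟩⟩
        rintro y ⟨u, hu, huy⟩
        exact (lt_iff hs huy).2 hu
      · rw [isOpen_iff_forall_mem_open]
        intro x hx
        obtain ⟨i, s, t, hs, ht⟩ := pair a x
        refine ⟨Subtype.val ⁻¹' (e i '' Iio s), ?_, himg i _ isOpen_Iio, ⟨t, (lt_iff ht hs).1 hx, ht⟩⟩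
        rintro y ⟨u, hu, huy⟩
        exact (lt_iff huy hs).2 hu
    · intro N hN
      refine (@isOpen_iff_forall_mem_open _
        (TopologicalSpace.generateFrom {s : Set U | ∃ a, s = Ioi a ∨ s = Iio a}) N).2 fun x hx => ?_
      obtain ⟨i, s, hs⟩ := mem_iUnion.1 x.2
      let E : ℝ → U := fun t => ⟨e i t, mem i t⟩
      have hE : Continuous E := (he i).continuous.subtype_mk _
      have hEs : E s = x := Subtype.ext hs
      obtain ⟨ε, hε, hball⟩ := Metric.isOpen_iff.1 (hN.preimage hE) s (by rwa [mem_preimage, hEs])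
      refine ⟨Ioi (E (s - ε)) ∩ Iio (E (s + ε)), ?_,
        TopologicalSpace.GenerateOpen.inter _ _ (.basic _ ⟨_, Or.inl rfl⟩) (.basic _ ⟨_, Or.inr rfl⟩), ?_⟩
      · rintro y ⟨h1, h2⟩
        obtain ⟨u, hu, huy⟩ := between i _ _ y h1 h2
        have : E u ∈ N := hball (by rwa [Real.ball_eq_Ioo])
        rwa [show E u = y from Subtype.ext huy] at this
      · exact ⟨(lt_iff rfl hs).2 (by linarith), (lt_iff hs rfl).2 (by linarith)⟩
  obtain ⟨g, hgm, hgc⟩ := exists_strictMono_continuous (Y := U)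
  have ivt : ∀ (i s t), s ≤ t → Icc (g ⟨e i s, mem i s⟩) (g ⟨e i t, mem i t⟩) ⊆ range g := by
    intro i s t hst
    refine (intermediate_value_Icc hst
      (f := fun t => g ⟨e i t, mem i t⟩) ?_).trans ?_
    · exact (hgc.comp ((he i).continuous.subtype_mk _)).continuousOn
    · rintro _ ⟨u, -, rfl⟩
      exact mem_range_self _
  refine isOpenArc_of_isEmbedding hUo (isEmbedding_of_strictMono hgm hgc) ?_ ?_ ?_
  · rw [isOpen_iff_mem_nhds]
    rintro _ ⟨x, rfl⟩
    obtain ⟨i, s, hs⟩ := mem_iUnion.1 x.2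
    refine mem_of_superset (Icc_mem_nhds ?_ ?_) (ivt i (s - 1) (s + 1) (by linarith))
    · exact hgm ((lt_iff rfl hs).2 (by linarith))
    · exact hgm ((lt_iff hs rfl).2 (by linarith))
  · refine OrdConnected.isPreconnected ⟨?_⟩
    rintro _ ⟨x, rfl⟩ _ ⟨y, rfl⟩
    obtain ⟨i, s, t, hs, ht⟩ := pair x y
    rcases le_total s t with h | h
    · have hx : x = ⟨e i s, mem i s⟩ := Subtype.ext hs.symm
      have hy : y = ⟨e i t, mem i t⟩ := Subtype.ext ht.symm
      rw [hx, hy]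
      exact ivt i s t h
    · intro z hz
      have : y ≤ x := (le_iff ht hs).2 h
      have hz' : z = g x := le_antisymm (hz.2.trans (hgm.monotone this)) hz.1
      exact ⟨x, hz'.symm⟩
  · obtain ⟨i⟩ := ‹Nonempty ι›
    exact ⟨e i 0, mem i 0⟩

/-- Every open arc lies in a maximal one. -/
theorem IsOpenArc.exists_maximal [SecondCountableTopology X] {V : Set X} (hV : IsOpenArc V) :
    ∃ M, V ⊆ M ∧ Maximal IsOpenArc M := by
  refine zorn_subset_nonempty {V : Set X | IsOpenArc V} ?_ V hV
  intro c hc hchain hne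
  obtain ⟨V₀, hV₀⟩ := hne
  obtain ⟨e₀, he₀, hr₀⟩ := hc hV₀
  -- Orienting every arc so that `e₀ 0` precedes `e₀ 1` rules out decreasing transition maps.
  -- Members of the chain inside `V₀` can be ignored.
  have horient : ∀ W : {W // W ∈ c ∧ V₀ ⊆ W}, ∃ e : ℝ → X, IsOpenEmbedding e ∧ range e = W ∧
      ∃ s t, s < t ∧ e s = e₀ 0 ∧ e t = e₀ 1 := by
    rintro ⟨W, hW, hVW⟩
    obtain ⟨e, he, hr⟩ := hc hW
    have hmem : ∀ u, e₀ u ∈ range e := fun u => by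
      rw [hr]; exact hVW (hr₀ ▸ mem_range_self u)
    obtain ⟨s, hs⟩ := hmem 0
    obtain ⟨t, ht⟩ := hmem 1
    rcases lt_trichotomy s t with h | h | h
    · exact ⟨e, he, hr, s, t, h, hs, ht⟩
    · rw [h] at hs
      exact absurd (he₀.injective (hs.symm.trans ht)) zero_ne_one
    · refine ⟨fun u => e (-u), he.comp (Homeomorph.neg ℝ).isOpenEmbedding, ?_, -s, -t,
        by linarith, by simpa using hs, by simpa using ht⟩
      exact ((Homeomorph.neg ℝ).surjective.range_comp e).trans hr
  choose e he hr s t hst hs ht using horient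
  have : Nonempty {W // W ∈ c ∧ V₀ ⊆ W} := ⟨⟨V₀, hV₀, subset_rfl⟩⟩
  have hφ : ∀ i j, range (e i) ⊆ range (e j) → ∃ φ : ℝ → ℝ, StrictMono φ ∧ e i = e j ∘ φ := by
    intro i j hij
    choose φ hφ using fun u => hij (mem_range_self (f := e i) u)
    have hφ' : e i = e j ∘ φ := funext fun u => (hφ u).symm
    have hφc : Continuous φ := (he j).isInducing.continuous_iff.2 (hφ' ▸ (he i).continuous)
    have hφi : Function.Injective φ := fun a b hab => by
      apply (he i).injective
      rw [← hφ, ← hφ, hab]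
    refine ⟨φ, (hφc.strictMono_of_inj hφi).resolve_right fun hanti => ?_, hφ'⟩
    have h1 : φ (s i) = s j := (he j).injective (by rw [hφ, hs, hs])
    have h2 : φ (t i) = t j := (he j).injective (by rw [hφ, ht, ht])
    have := hanti (hst i)
    rw [h1, h2] at this
    exact (this.trans (hst j)).false
  have harc := isOpenArc_iUnion he fun i j => by
    have h := hchain.total i.2.1 j.2.1
    rw [← hr i, ← hr j] at h
    exact h.imp (hφ i j) (hφ j i)
  refine ⟨_, harc, fun W hW => ?_⟩
  rcases hchain.total hV₀ hW with h | h
  · exact (hr ⟨W, hW, h⟩).ge.trans (subset_iUnion (fun i => range (e i)) _)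
  · exact h.trans ((hr ⟨V₀, hV₀, subset_rfl⟩).ge.trans (subset_iUnion (fun i => range (e i)) _))

end Arcs

/-! ### Clopen neighbourhoods from maximal arcs. -/

section Hulls

variable {X : Type*} [TopologicalSpace X]

theorem isEmbeddingOn_invFun {e : ℝ → X} (he : IsEmbedding e) :
    IsEmbeddingOn (Function.invFun e) (range e) := by
  have hl : Function.LeftInverse (Function.invFun e) e := Function.leftInverse_invFun he.injective
  refine ⟨?_, ?_⟩
  · rintro _ ⟨s, rfl⟩ _ ⟨t, rfl⟩ hst
    rw [hl, hl] at hst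
    rw [hst]
  · rintro _ ⟨t, rfl⟩
    rw [← he.map_nhds_eq, hl, ← map_comap, comap_comap, hl.comp_eq_id, comap_id]

/-- A chart around the limit `q` of the upper end of the arc `e`, such that the arc enters the
chart at time `T` and traces out exactly its negative side. -/
structure IsEndChart (e : ℝ → X) (f : X → ℝ) (C : Set X) (q : X) (T : ℝ) : Prop where
  chart : IsChart f C q
  injective : Function.Injective e
  map_eq : f (e T) = -1
  image_eq : e '' Ici T = C ∩ f ⁻¹' Iio 0
  inter_range : C ∩ range e ⊆ e '' Ici T
  subset_image : Ico (-1) 0 ⊆ f '' C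

/-- After a change of sign the arc reaches `q` from below. Since the lower end does not cluster at
`q`, the earlier part of the arc stays away from `q`, and zooming in on the chart removes it. -/
theorem exists_isEndChart [T2Space X] {e : ℝ → X} {q : X} {N : Set X}
    (hX : ∃ f C, IsChart f C q ∧ C ⊆ N) (he : IsOpenEmbedding e)
    (hq : MapClusterPt q atTop e) (hq' : ¬ MapClusterPt q atBot e) (T₀ : ℝ) :
    ∃ f C, ∃ T ≥ T₀, IsEndChart e f C q T ∧ C ⊆ N := by
  have hqe := notMem_range_of_mapClusterPt he hq
  obtain ⟨f, C, h, hCN⟩ := hX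
  obtain ⟨T, hT₀, hTC, hm⟩ := h.exists_strictMonoOn he.continuous he.injective hq T₀
  wlog hm₁ : StrictMonoOn (f ∘ e) (Ici T) generalizing f
  · have hm₂ := hm.resolve_left hm₁
    exact this _ h.neg (Or.inl hm₂) hm₂
  obtain ⟨h1, h2, -⟩ := h.image_Ici_eq he.continuous hq hTC hm₁
  have hqc : (closure (e '' Iic T))ᶜ ∈ 𝓝 q :=
    isClosed_closure.isOpen_compl.mem_nhds fun hc => hq'
      (mapClusterPt_of_mem_closure_image_Iic he.continuous hc fun hc' =>
        hqe (image_subset_range _ _ hc'))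
  obtain ⟨ε, hε, hεN⟩ := h.emb.exists_pos h.mem hqc
  simp only [h.map_eq, sub_zero] at hεN
  have hb := h.bound _ (hTC T le_rfl)
  -- `η < ε` excludes `e '' Iic T` from the window; `η ≤ -f (e T)` guarantees that the arc takes the
  -- value `-η` after `T`.
  obtain ⟨η, hη, hηε, hηT⟩ : ∃ η > 0, η < ε ∧ η ≤ -f (e T) :=
    ⟨min (ε / 2) (-f (e T)), lt_min (by linarith) (by linarith),
      (min_le_left _ _).trans_lt (by linarith), min_le_right _ _⟩
  have hη1 : η ≤ 1 := by linarith [hb.1]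
  obtain ⟨T₁, hT₁, hT₁η⟩ : ∃ T₁ ≥ T, f (e T₁) = -η := by
    obtain ⟨-, -, h3⟩ := h.image_Ici_eq he.continuous hq hTC hm₁
    have hmem : -η ∈ Ico (f (e T)) 0 := ⟨by linarith, by linarith⟩
    obtain ⟨y, hy, hfy⟩ := h3 hmem
    have hy' : y ∈ e '' Ici T := by
      rw [h2]
      exact ⟨hy, by rwa [mem_preimage, hfy]⟩
    obtain ⟨t, ht, rfl⟩ := hy'
    exact ⟨t, ht, hfy⟩
  obtain ⟨-, h4, h5⟩ := h.image_Ici_eq he.continuous hq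
    (fun t ht => hTC t (le_trans hT₁ ht)) (hm₁.mono (Ici_subset_Ici.2 hT₁))
  rw [hT₁η] at h4 h5
  refine ⟨_, _, T₁, le_trans hT₀ hT₁, ⟨h.rescale hη hη1, he.injective, ?_, ?_, ?_, ?_⟩,
    inter_subset_left.trans hCN⟩
  · rw [hT₁η, neg_div, div_self hη.ne']
  · rw [h4]
    ext x
    simp only [mem_inter_iff, mem_preimage, mem_Ico, mem_Icc, mem_Iio, div_lt_iff₀ hη, zero_mul]
    constructor
    · rintro ⟨hx, h6, h7⟩
      exact ⟨⟨hx, h6, by linarith⟩, h7⟩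
    · rintro ⟨⟨hx, h6, -⟩, h7⟩
      exact ⟨hx, h6, h7⟩
  · rintro _ ⟨⟨hC, hf⟩, t, rfl⟩
    have ht : T ≤ t := by
      by_contra! hc
      refine hεN _ hC ?_ (subset_closure ⟨t, hc.le, rfl⟩)
      exact (abs_le.2 hf).trans_lt hηε
    have hneg : f (e t) < 0 := by
      have : e t ∈ e '' Ici T := ⟨t, ht, rfl⟩
      rw [h2] at this
      exact this.2.2
    rw [h4]
    exact ⟨hC, hf.1, hneg⟩
  · intro y hy
    obtain ⟨x, hx, hxy⟩ := h5 (show η * y ∈ Ico (-η) 0 from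
      ⟨by nlinarith [hy.1], mul_neg_of_pos_of_neg hη hy.2⟩)
    have hy2 : η * y < 0 := mul_neg_of_pos_of_neg hη hy.2
    refine ⟨x, ⟨hx, ?_, ?_⟩, ?_⟩
    · rw [hxy]; nlinarith [hy.1]
    · rw [hxy]; linarith
    · simp only [hxy]
      field_simp

namespace IsEndChart

variable {e : ℝ → X} {f : X → ℝ} {C : Set X} {q : X} {T : ℝ}

theorem mem_of_le (h : IsEndChart e f C q T) {t : ℝ} (ht : T ≤ t) :
    e t ∈ C ∧ f (e t) < 0 := by
  have : e t ∈ e '' Ici T := ⟨t, ht, rfl⟩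
  rw [h.image_eq] at this
  exact this

theorem le_of_mem (h : IsEndChart e f C q T) {t : ℝ} (ht : e t ∈ C) : T ≤ t := by
  obtain ⟨s, hs, hst⟩ := h.inter_range ⟨ht, t, rfl⟩
  rwa [← h.injective hst]

theorem eq_of_map_eq (h : IsEndChart e f C q T) {x : X} (hx : x ∈ C) (hfx : f x = -1) :
    x = e T :=
  h.chart.emb.1 hx (h.mem_of_le le_rfl).1 (hfx.trans h.map_eq.symm)

/-- Extending the parametrisation of an arc beyond its end by a chart. -/
theorem exists_isEmbeddingOn (h : IsEndChart e f C q T) (he : IsEmbedding e) {I J : Set ℝ}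
    (hJ : J ⊆ Iic T) (hTJ : T ∈ J) (hI : I ⊆ Ico (-1) 1) (hI' : -1 ∈ I)
    (hIC : closure (C ∩ f ⁻¹' I) ⊆ C) :
    ∃ g : X → ℝ, IsEmbeddingOn g (e '' J ∪ C ∩ f ⁻¹' I) ∧ (∀ t ∈ J, g (e t) = t - T - 1) ∧
      ∀ x ∈ C ∩ f ⁻¹' I, g x = f x := by
  classical
  -- The shift makes the arc parameter agree with `f` at the gluing point, where both equal `-1`.
  let g : X → ℝ := fun x => if x ∈ e '' J then Function.invFun e x - T - 1 else f x
  have hgJ : ∀ t ∈ J, g (e t) = t - T - 1 := fun t ht => by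
    change (if e t ∈ e '' J then _ else _) = _
    rw [if_pos ⟨t, ht, rfl⟩, Function.leftInverse_invFun he.injective t]
  have hJC : ∀ t ∈ J, e t ∈ C → t = T := fun t ht hC => le_antisymm (hJ ht) (h.le_of_mem hC)
  have hgI : ∀ x ∈ C ∩ f ⁻¹' I, g x = f x := by
    rintro x ⟨hx, -⟩
    by_cases hxJ : x ∈ e '' J
    · obtain ⟨t, ht, rfl⟩ := hxJ
      rw [hgJ t ht, hJC t ht hx, h.map_eq]
      ring
    · exact if_neg hxJ
  have hTI : e T ∈ C ∩ f ⁻¹' I := ⟨(h.mem_of_le le_rfl).1, by rwa [mem_preimage, h.map_eq]⟩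
  have hgT : g (e T) = -1 := by rw [hgJ T hTJ]; ring
  refine ⟨g, IsEmbeddingOn.union (p := e T) ?_ ?_ ⟨T, hTJ, rfl⟩ hTI ?_ ?_ ?_ ?_, hgJ, hgI⟩
  · have h1 : IsEmbeddingOn (fun x => Function.invFun e x - (T + 1)) (e '' J) :=
      ((isEmbeddingOn_invFun he).mono (image_subset_range _ _)).comp
        (k := fun t => t - (T + 1)) (Homeomorph.subRight (T + 1)).isEmbedding
    refine h1.congr ?_
    rintro _ ⟨t, ht, rfl⟩
    change Function.invFun e (e t) - (T + 1) = _
    rw [hgJ t ht, Function.leftInverse_invFun he.injective t]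
    ring
  · exact (h.chart.emb.mono inter_subset_left).congr fun x hx => (hgI x hx).symm
  · rintro _ ⟨t, ht, rfl⟩ hne
    have : t < T := lt_of_le_of_ne (hJ ht) fun hc => hne (by rw [hc])
    rw [hgT, hgJ t ht]
    linarith
  · intro x hx hne
    rw [hgT, hgI x hx]
    exact lt_of_le_of_ne (hI hx.2).1 fun hc => hne (h.eq_of_map_eq hx.1 hc.symm)
  · rintro _ ⟨⟨t, ht, rfl⟩, hc⟩
    rw [hJC t ht (hIC hc)]
    exact hTI
  · rintro x ⟨hx, hc⟩
    rcases (hI hx.2).1.eq_or_lt with hf | hf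
    · exact ⟨T, hTJ, (h.eq_of_map_eq hx.1 hf.symm).symm⟩
    · obtain ⟨_, ⟨hyC, hy⟩, t, ht, rfl⟩ :=
        mem_closure_iff.1 hc _ h.chart.isOpen ⟨hx.1, hf, (hI hx.2).2⟩
      rw [hJC t ht hyC, mem_preimage, h.map_eq] at hy
      exact absurd hy.1 (lt_irrefl _)

/-- A maximal arc cannot be extended beyond its end, so there are gaps on the other side. -/
theorem exists_notMem_image (h : IsEndChart e f C q T) (he : IsOpenEmbedding e)
    (hq : q ∉ range e) (hmax : Maximal IsOpenArc (range e)) :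
    ∃ b ∈ Ioo (0 : ℝ) 1, b ∉ f '' C := by
  -- Without a gap the glued embedding has image `Iio 1`, so its domain is an open arc containing
  -- both `range e` and `q`, against maximality.
  by_contra! hfull
  obtain ⟨g, hg, hgJ, hgI⟩ := h.exists_isEmbeddingOn he.isEmbedding (J := Iic T) (I := Ico (-1) 1)
    subset_rfl self_mem_Iic subset_rfl ⟨le_rfl, by norm_num⟩
    (closure_minimal inter_subset_left h.chart.isClosed)
  set W := e '' Iic T ∪ C ∩ f ⁻¹' Ico (-1) 1 with hW
  have hWe : W = range e ∪ C ∩ f ⁻¹' Ioo (-1) 1 := by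
    ext x
    constructor
    · rintro (hx | ⟨hx, hfx⟩)
      · exact Or.inl (image_subset_range _ _ hx)
      · rcases hfx.1.eq_or_lt with hf | hf
        · exact Or.inl ⟨T, (h.eq_of_map_eq hx hf.symm).symm⟩
        · exact Or.inr ⟨hx, hf, hfx.2⟩
    · rintro (⟨t, rfl⟩ | ⟨hx, hfx⟩)
      · rcases le_total t T with ht | ht
        · exact Or.inl ⟨t, ht, rfl⟩
        · obtain ⟨h1, h2⟩ := h.mem_of_le ht
          exact Or.inr ⟨h1, (h.chart.bound _ h1).1, by linarith⟩
      · exact Or.inr ⟨hx, hfx.1.le, hfx.2⟩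
  have hqW : q ∈ W := Or.inr ⟨h.chart.mem, by rw [mem_preimage, h.chart.map_eq]; norm_num⟩
  have himg : range (W.domRestrict g) = Iio 1 := by
    rw [range_domRestrict]
    ext y
    constructor
    · rintro ⟨x, ⟨t, ht, rfl⟩ | hx, rfl⟩
      · rw [hgJ t ht, mem_Iio]
        linarith [mem_Iic.1 ht]
      · rw [hgI x hx]
        exact hx.2.2
    · intro hy
      by_cases hy1 : y < -1
      · have ht : y + T + 1 ∈ Iic T := by rw [mem_Iic]; linarith
        exact ⟨e (y + T + 1), Or.inl ⟨_, ht, rfl⟩, by rw [hgJ _ ht]; ring⟩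
      · rw [not_lt] at hy1
        have hyC : y ∈ f '' C := by
          rcases lt_trichotomy y 0 with h0 | h0 | h0
          · exact h.subset_image ⟨hy1, h0⟩
          · exact ⟨q, h.chart.mem, h.chart.map_eq.trans h0.symm⟩
          · exact hfull y ⟨h0, hy⟩
        obtain ⟨x, hx, rfl⟩ := hyC
        exact ⟨x, Or.inr ⟨hx, hy1, hy⟩, hgI x ⟨hx, hy1, hy⟩⟩
  have harc : IsOpenArc W := by
    refine isOpenArc_of_isEmbedding ?_ (isEmbeddingOn_iff.1 hg) ?_ ?_ ⟨q, hqW⟩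
    · rw [hWe]
      exact he.isOpen_range.union h.chart.isOpen
    · rw [himg]; exact isOpen_Iio
    · rw [himg]; exact isPreconnected_Iio
  exact hq (hmax.2 harc (hWe ▸ subset_union_left) hqW)

end IsEndChart

/-- The upper half of a maximal arc, enlarged by points accumulating at its end. -/
theorem exists_isClosed_superset_image_Ici [T2Space X]
    (hX : ∀ (q : X), ∀ N ∈ 𝓝 q, ∃ f C, IsChart f C q ∧ C ⊆ N) {e : ℝ → X}
    (he : IsOpenEmbedding e) (hmax : Maximal IsOpenArc (range e))
    (hnc : ∀ q, MapClusterPt q atTop e → ¬ MapClusterPt q atBot e) {F : Set X} (hF : IsClosed F)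
    (hFe : ∀ q, MapClusterPt q atTop e → q ∉ F) :
    ∃ (B : Set X) (g : X → ℝ), IsClosed B ∧ IsEmbeddingOn g B ∧ e '' Ici 0 ⊆ B ∧
      B ∩ range e ⊆ e '' Ici 0 ∧ IsOpen (B \ {e 0}) ∧ B ∩ F ⊆ range e ∧ g (e 0) = 0 ∧
      ∀ x ∈ B, x ≠ e 0 → 0 < g x := by
  have hl := Function.leftInverse_invFun he.injective
  by_cases hcl : ∃ q, MapClusterPt q atTop e
  swap
  · refine ⟨e '' Ici 0, Function.invFun e, ?_,
      (isEmbeddingOn_invFun he.isEmbedding).mono (image_subset_range _ _), subset_rfl,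
      inter_subset_left, ?_, inter_subset_left.trans (image_subset_range _ _), hl 0, ?_⟩
    · refine isClosed_of_closure_subset fun x hx => ?_
      by_contra hc
      exact hcl ⟨x, mapClusterPt_of_mem_closure_image_Ici he.continuous hx hc⟩
    · rw [← image_singleton, ← image_sdiff he.injective, Ici_sdiff_left]
      exact he.isOpenMap _ isOpen_Ioi
    · rintro _ ⟨t, ht, rfl⟩ hne
      rw [hl]
      exact lt_of_le_of_ne ht fun hc => hne (by rw [← hc])
  obtain ⟨q, hq⟩ := hcl
  obtain ⟨f, C, T, hT, h, hCF⟩ := exists_isEndChart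
    (hX q _ (hF.isOpen_compl.mem_nhds (hFe q hq))) he hq (hnc q hq) 0
  -- Cutting at the omitted value `b` makes the closed piece of chart also open, apart from its
  -- starting point `e T`, which is either interior to the half arc or equal to `e 0`.
  obtain ⟨b, hb, hbC⟩ := h.exists_notMem_image he (notMem_range_of_mapClusterPt he hq) hmax
  have hBC : IsClosed (C ∩ f ⁻¹' Icc (-1) b) := h.chart.isClosed_inter isClosed_Icc
  obtain ⟨g, hg, hgJ, hgI⟩ := h.exists_isEmbeddingOn he.isEmbedding (J := Icc 0 T)
    (I := Icc (-1) b) (fun t ht => ht.2) ⟨hT, le_rfl⟩ (Icc_subset_Ico_right hb.2)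
    ⟨le_rfl, by linarith [hb.1]⟩ (hBC.closure_eq.subset.trans inter_subset_left)
  have hg' : IsEmbeddingOn (fun x => g x + (T + 1)) (e '' Icc 0 T ∪ C ∩ f ⁻¹' Icc (-1) b) :=
    hg.comp (k := fun t => t + (T + 1)) (Homeomorph.addRight (T + 1)).isEmbedding
  have hsub : e '' Ici 0 ⊆ e '' Icc 0 T ∪ C ∩ f ⁻¹' Icc (-1) b := by
    rintro _ ⟨t, ht, rfl⟩
    rcases le_total t T with htT | htT
    · exact Or.inl ⟨t, ⟨ht, htT⟩, rfl⟩
    · obtain ⟨h1, h2⟩ := h.mem_of_le htT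
      exact Or.inr ⟨h1, (h.chart.bound _ h1).1, by linarith [hb.1]⟩
  refine ⟨_, _, (isCompact_Icc.image he.continuous).isClosed.union hBC, hg', hsub, ?_, ?_, ?_, ?_,
    ?_⟩
  · rintro x ⟨⟨t, ht, rfl⟩ | hx, hxe⟩
    · exact ⟨t, ht.1, rfl⟩
    · exact image_mono (Ici_subset_Ici.2 hT) (h.inter_range ⟨hx.1, hxe⟩)
  · have : (e '' Icc 0 T ∪ C ∩ f ⁻¹' Icc (-1) b) \ {e 0} =
        e '' Ioi 0 ∪ C ∩ f ⁻¹' Ioo (-1) b := by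
      ext x
      constructor
      · rintro ⟨⟨t, ht, rfl⟩ | ⟨hx, hfx⟩, hne⟩
        · exact Or.inl ⟨t, lt_of_le_of_ne ht.1 fun hc => hne (by rw [← hc]; rfl), rfl⟩
        · rcases hfx.1.eq_or_lt with hf | hf
          · have hxT := h.eq_of_map_eq hx hf.symm
            rw [hxT] at hne ⊢
            exact Or.inl ⟨T, lt_of_le_of_ne hT fun hc => hne (by rw [← hc]; rfl), rfl⟩
          · exact Or.inr ⟨hx, hf, lt_of_le_of_ne hfx.2 fun hc => hbC ⟨x, hx, hc⟩⟩
      · rintro (⟨t, ht, rfl⟩ | ⟨hx, hfx⟩)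
        · exact ⟨hsub ⟨t, (mem_Ioi.1 ht).le, rfl⟩, fun hc => (ne_of_gt ht) (he.injective hc)⟩
        · refine ⟨Or.inr ⟨hx, hfx.1.le, hfx.2.le⟩, ?_⟩
          rintro rfl
          have hT0 : T = 0 := le_antisymm (h.le_of_mem hx) hT
          rw [mem_preimage, ← hT0, h.map_eq] at hfx
          exact lt_irrefl _ hfx.1
    rw [this]
    exact (he.isOpenMap _ isOpen_Ioi).union
      (h.chart.isOpen_inter isOpen_Ioo (Ioo_subset_Ioo_right hb.2.le))
  · rintro x ⟨hx | hx, hxF⟩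
    · exact image_subset_range _ _ hx
    · exact absurd hxF (hCF hx.1)
  · simp only [hgJ 0 ⟨le_rfl, hT⟩]
    ring
  · rintro x (⟨t, ht, rfl⟩ | hx) hne
    · simp only [hgJ t ht]
      have : 0 < t := lt_of_le_of_ne ht.1 fun hc => hne (by rw [← hc])
      linarith
    · simp only [hgI x hx]
      by_contra! hc
      have h1 : f x = -1 := le_antisymm (by linarith) hx.2.1
      have h2 : T = 0 := le_antisymm (by linarith) hT
      exact hne (h2 ▸ h.eq_of_map_eq hx.1 h1)

/-- A maximal arc with distinct ends is contained in a clopen set embedding into the line. -/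
theorem exists_isClopen_isEmbeddingOn_of_maximal [T2Space X]
    (hX : ∀ (q : X), ∀ N ∈ 𝓝 q, ∃ f C, IsChart f C q ∧ C ⊆ N) {e : ℝ → X}
    (he : IsOpenEmbedding e) (hmax : Maximal IsOpenArc (range e))
    (hnc : ∀ q, MapClusterPt q atTop e → ¬ MapClusterPt q atBot e) :
    ∃ W, IsClopen W ∧ range e ⊆ W ∧ ∃ g, IsEmbeddingOn g W := by
  classical
  obtain ⟨B₁, g₁, hc₁, hg₁, hs₁, hr₁, ho₁, -, hz₁, hp₁⟩ :=
    exists_isClosed_superset_image_Ici hX he hmax hnc isClosed_empty fun _ _ => notMem_empty _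
  let e' : ℝ → X := fun t => e (-t)
  have he' : IsOpenEmbedding e' := he.comp (Homeomorph.neg ℝ).isOpenEmbedding
  have hre : range e' = range e := (Homeomorph.neg ℝ).surjective.range_comp e
  have hcl : ∀ q, MapClusterPt q atTop e' ↔ MapClusterPt q atBot e := fun q =>
    mapClusterPt_neg_iff
  have hcl' : ∀ q, MapClusterPt q atBot e' ↔ MapClusterPt q atTop e := fun q => by
    rw [← mapClusterPt_neg_iff]
    simp [e']
  -- Such a `q` would have `B₁ \ {e 0}` as an open neighbourhood, but `B₁` meets the arc only at
  -- nonnegative times. The second half can thus avoid what the first added, so they share only `e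
  -- 0`.
  have hF : ∀ q, MapClusterPt q atTop e' → q ∉ B₁ \ range e := by
    rintro q hq ⟨hqB, hqe⟩
    have hq0 : q ∈ B₁ \ {e 0} := ⟨hqB, fun hc => hqe ⟨0, hc.symm⟩⟩
    obtain ⟨t, ht, ht'⟩ := ((hq.frequently (ho₁.mem_nhds hq0)).and_eventually
      (eventually_gt_atTop 0)).exists
    obtain ⟨s, hs, hst⟩ := hr₁ ⟨ht.1, -t, rfl⟩
    have := he.injective hst
    rw [mem_Ici] at hs
    linarith
  obtain ⟨B₂, g₂, hc₂, hg₂, hs₂, hr₂, ho₂, hF₂, hz₂, hp₂⟩ :=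
    exists_isClosed_superset_image_Ici hX he' (hre ▸ hmax)
      (fun q hq hq' => hnc q ((hcl' q).1 hq') ((hcl q).1 hq))
      (hc₁.sdiff he.isOpen_range) hF
  have he0 : e' 0 = e 0 := congrArg e neg_zero
  rw [he0] at ho₂ hz₂ hp₂
  rw [hre] at hr₂ hF₂
  have hm₁ : e 0 ∈ B₁ := hs₁ ⟨0, self_mem_Ici, rfl⟩
  have hm₂ : e 0 ∈ B₂ := hs₂ ⟨0, self_mem_Ici, he0⟩
  have hinter : ∀ x ∈ B₁, x ∈ B₂ → x = e 0 := by
    intro x h1 h2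
    have hxe : x ∈ range e := by
      by_contra hc
      exact hc (hF₂ ⟨h2, h1, hc⟩)
    obtain ⟨s, hs, rfl⟩ := hr₁ ⟨h1, hxe⟩
    obtain ⟨t, ht, hst⟩ := hr₂ ⟨h2, hxe⟩
    have := he.injective hst
    rw [mem_Ici] at hs ht
    rw [show s = 0 by linarith]
  have hrange : range e ⊆ B₂ ∪ B₁ := by
    rintro _ ⟨t, rfl⟩
    rcases le_total 0 t with ht | ht
    · exact Or.inr (hs₁ ⟨t, ht, rfl⟩)
    · exact Or.inl (hs₂ ⟨-t, neg_nonneg.2 ht, congrArg e (neg_neg t)⟩)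
  let g : X → ℝ := fun x => if x ∈ B₁ then g₁ x else -g₂ x
  have hgB₁ : EqOn g₁ g B₁ := fun x hx => (if_pos hx).symm
  have hgB₂ : EqOn (fun x => -g₂ x) g B₂ := by
    intro x hx
    by_cases h1 : x ∈ B₁
    · rw [hinter x h1 hx, ← hgB₁ hm₁, hz₁]
      simp [hz₂]
    · exact (if_neg h1).symm
  have hg0 : g (e 0) = 0 := by rw [← hgB₁ hm₁, hz₁]
  refine ⟨B₂ ∪ B₁, ⟨hc₂.union hc₁, ?_⟩, hrange, g, ?_⟩
  · have : B₂ ∪ B₁ = (B₂ \ {e 0}) ∪ (B₁ \ {e 0}) ∪ range e := by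
      rw [← union_sdiff_distrib]
      refine Subset.antisymm (fun x hx => ?_) (union_subset sdiff_subset hrange)
      by_cases hx0 : x = e 0
      · exact Or.inr ⟨0, hx0.symm⟩
      · exact Or.inl ⟨hx, hx0⟩
    rw [this]
    exact (ho₂.union ho₁).union he.isOpen_range
  · refine IsEmbeddingOn.union (p := e 0) ?_ (hg₁.congr hgB₁) hm₂ hm₁ ?_ ?_ ?_ ?_
    · exact (hg₂.comp (Homeomorph.neg ℝ).isEmbedding).congr hgB₂
    · intro x hx hne
      rw [hg0, ← hgB₂ hx]
      exact neg_neg_of_pos (hp₂ x hx hne)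
    · intro x hx hne
      rw [hg0, ← hgB₁ hx]
      exact hp₁ x hx hne
    · rw [hc₁.closure_eq]; exact inter_subset_right
    · rw [hc₂.closure_eq]; exact inter_subset_right

/-- Around a point with gaps on both sides a chart contains a small clopen set; otherwise the point
is a limit of an open arc. -/
theorem IsChart.exists_isClopen_or_mem_closure {f : X → ℝ} {C : Set X} {q : X}
    (h : IsChart f C q) :
    (∃ W, IsClopen W ∧ q ∈ W ∧ IsEmbeddingOn f W) ∨ ∃ V, IsOpenArc V ∧ q ∈ closure V := by
  have key : ∀ {f : X → ℝ}, IsChart f C q → Ioo 0 1 ⊆ f '' C →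
      ∃ V, IsOpenArc V ∧ q ∈ closure V := by
    intro f h hfull
    have himg : range ((C ∩ f ⁻¹' Ioo 0 1).domRestrict f) = Ioo 0 1 := by
      rw [range_domRestrict, image_inter_preimage, inter_eq_right.2 hfull]
    refine ⟨C ∩ f ⁻¹' Ioo 0 1, isOpenArc_of_isEmbedding
      (h.isOpen_inter isOpen_Ioo (Ioo_subset_Ioo_left (by norm_num)))
      (isEmbeddingOn_iff.1 (h.emb.mono inter_subset_left)) ?_ ?_ ?_, ?_⟩
    · rw [himg]; exact isOpen_Ioo
    · rw [himg]; exact isPreconnected_Ioo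
    · obtain ⟨x, hx, hfx⟩ := hfull (show (1 / 2 : ℝ) ∈ Ioo 0 1 by norm_num)
      exact ⟨x, hx, by rw [mem_preimage, hfx]; norm_num⟩
    · rw [mem_closure_iff_nhds]
      intro N hN
      obtain ⟨ε, hε, hεN⟩ := h.emb.exists_pos h.mem hN
      have hm : 0 < min (ε / 2) (1 / 2) := lt_min (by linarith) (by norm_num)
      have hy : min (ε / 2) (1 / 2) ∈ Ioo (0 : ℝ) 1 :=
        ⟨hm, (min_le_right _ _).trans_lt (by norm_num)⟩
      obtain ⟨x, hx, hfx⟩ := hfull hy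
      refine ⟨x, hεN x hx ?_, hx, by rwa [mem_preimage, hfx]⟩
      rw [h.map_eq, sub_zero, hfx, abs_of_pos hm]
      exact (min_le_left _ _).trans_lt (by linarith)
  by_cases h1 : Ioo 0 1 ⊆ f '' C
  · exact Or.inr (key h h1)
  by_cases h2 : Ioo 0 1 ⊆ (fun x => -f x) '' C
  · exact Or.inr (key h.neg h2)
  -- Omitted values on both sides of 0 bound a window that is both closed and open.
  left
  obtain ⟨b, hb, hbC⟩ := not_subset.1 h1
  obtain ⟨a, ha, haC⟩ := not_subset.1 h2
  refine ⟨C ∩ f ⁻¹' Icc (-a) b, ⟨h.isClosed_inter isClosed_Icc, ?_⟩, ⟨h.mem, ?_⟩,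
    h.emb.mono inter_subset_left⟩
  · convert h.isOpen_inter (I := Ioo (-a) b) isOpen_Ioo
      (Ioo_subset_Ioo (by linarith [ha.2]) hb.2.le) using 1
    ext x
    constructor
    · rintro ⟨hx, hx1, hx2⟩
      exact ⟨hx, lt_of_le_of_ne hx1 fun hc => haC ⟨x, hx, by simp [← hc]⟩,
        lt_of_le_of_ne hx2 fun hc => hbC ⟨x, hx, hc⟩⟩
    · rintro ⟨hx, hx1, hx2⟩
      exact ⟨hx, hx1.le, hx2.le⟩
  · rw [mem_preimage, h.map_eq]
    exact ⟨by linarith [ha.1], hb.1.le⟩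

/-- Each point of a second-countable regularly locally ordered space has a clopen neighbourhood
which is a circle or embeds into the real line. -/
theorem RegularlyLocallyOrdered.exists_isClopen [SecondCountableTopology X]
    (hX : RegularlyLocallyOrdered X) (x : X) :
    ∃ W, IsClopen W ∧ x ∈ W ∧ ((∃ g, IsEmbeddingOn g W) ∨ Nonempty (W ≃ₜ Circle)) := by
  have := hX.t3Space
  have hch : ∀ (q : X), ∀ N ∈ 𝓝 q, ∃ f C, IsChart f C q ∧ C ⊆ N := fun q N hN =>
    hX.exists_isChart q hN
  obtain ⟨f, C, h, -⟩ := hch x univ univ_mem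
  rcases h.exists_isClopen_or_mem_closure with ⟨W, hW, hxW, hf⟩ | ⟨V, hV, hxV⟩
  · exact ⟨W, hW, hxW, Or.inl ⟨f, hf⟩⟩
  obtain ⟨M, hVM, hM⟩ := hV.exists_maximal
  obtain ⟨e, he, rfl⟩ := hM.1
  have hx := closure_mono hVM hxV
  by_cases hnc : ∃ q, MapClusterPt q atTop e ∧ MapClusterPt q atBot e
  · obtain ⟨q, hq, hq'⟩ := hnc
    obtain ⟨h1, h2⟩ := isClopen_insert_range (hch q) he hq hq'
    exact ⟨_, h1, closure_minimal (subset_insert _ _) h1.1 hx, Or.inr h2⟩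
  · push Not at hnc
    obtain ⟨W, hW, hs, hg⟩ := exists_isClopen_isEmbeddingOn_of_maximal hch he hM hnc
    exact ⟨W, hW, closure_minimal hs hW.1 hx, Or.inl hg⟩

end Hulls

/-! ### Countable clopen partition and assembly. -/

section Decomposition

variable {X : Type*} [TopologicalSpace X]

/-- Pairwise disjoint open sets embedding into the line have a union embedding into the line. -/
theorem exists_isEmbeddingOn_iUnion {D : ℕ → Set X} (hD : ∀ n, IsOpen (D n))
    (hdisj : Pairwise (Function.onFun Disjoint D)) (h : ∀ n, ∃ g, IsEmbeddingOn g (D n)) :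
    ∃ g, IsEmbeddingOn g (⋃ n, D n) := by
  classical
  obtain ⟨k, hk, hkr⟩ := exists_isOpenEmbedding_range_eq_Ioo zero_lt_one
  choose g hg using h
  let N : X → ℕ := fun x => if hx : ∃ n, x ∈ D n then hx.choose else 0
  have hN : ∀ {n x}, x ∈ D n → N x = n := by
    intro n x hx
    have hx' : ∃ n, x ∈ D n := ⟨n, hx⟩
    by_contra hne
    rw [show N x = hx'.choose from dif_pos hx'] at hne
    exact disjoint_left.1 (hdisj hne) hx'.choose_spec hx
  -- Piece `n` goes into the open interval `(n, n + 1)`, so values near `G x` come only from the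
  -- piece of `x`.
  let G : X → ℝ := fun x => k (g (N x) x) + N x
  have hk01 : ∀ t, k t ∈ Ioo (0 : ℝ) 1 := fun t => hkr ▸ mem_range_self t
  have hGD : ∀ n, IsEmbeddingOn G (D n) := by
    intro n
    have h1 : IsEmbeddingOn (fun x => k (g n x) + n) (D n) :=
      (hg n).comp (k := fun t => k t + n)
        ((Homeomorph.addRight (n : ℝ)).isEmbedding.comp hk.isEmbedding)
    exact h1.congr fun x hx => by simp only [G, hN hx]
  have hGn : ∀ {n x}, x ∈ D n → G x ∈ Ioo (n : ℝ) (n + 1) := by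
    intro n x hx
    have := hk01 (g n x)
    simp only [G, hN hx]
    exact ⟨by linarith [this.1], by linarith [this.2]⟩
  have huniq : ∀ {n m : ℕ} {x : X}, x ∈ D m → G x ∈ Ioo (n : ℝ) (n + 1) → x ∈ D n := by
    intro n m x hx hxn
    have h2 := hGn hx
    have h3 : (n : ℝ) < m + 1 := hxn.1.trans h2.2
    have h4 : (m : ℝ) < n + 1 := h2.1.trans hxn.2
    norm_cast at h3 h4
    rwa [show n = m by omega]
  refine ⟨G, fun x hx y hy hxy => ?_, fun x hx => ?_⟩
  · obtain ⟨n, hn⟩ := mem_iUnion.1 hx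
    obtain ⟨m, hm⟩ := mem_iUnion.1 hy
    exact (hGD n).1 hn (huniq hm (hxy ▸ hGn hn)) hxy
  · obtain ⟨n, hn⟩ := mem_iUnion.1 hx
    have h1 : 𝓝[⋃ n, D n] x = 𝓝[D n] x := by
      rw [((hD n).nhdsWithin_eq hn), (isOpen_iUnion hD).nhdsWithin_eq hx]
    rw [h1, (hGD n).2 x hn]
    refine le_antisymm (inf_le_inf_left _ (principal_mono.2 (subset_iUnion D n))) ?_
    refine le_inf inf_le_left ?_
    rw [le_principal_iff, mem_inf_principal]
    refine ⟨_, isOpen_Ioo.mem_nhds (hGn hn), fun y hy hyU => ?_⟩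
    obtain ⟨m, hm⟩ := mem_iUnion.1 hyU
    exact huniq hm hy

theorem isEmbeddingOn_empty (g : X → ℝ) : IsEmbeddingOn g ∅ :=
  ⟨injOn_empty g, fun _ hx => hx.elim⟩

/-- A clopen subset of a circle is that circle or empty. -/
theorem eq_empty_or_eq_of_homeomorph_circle {D W : Set X} (φ : W ≃ₜ Circle) (hD : IsClopen D)
    (hDW : D ⊆ W) : D = ∅ ∨ D = W := by
  have : PreconnectedSpace Circle :=
    Circle.exp_surjective.denseRange.preconnectedSpace Circle.exp.continuous
  have : PreconnectedSpace W := φ.symm.surjective.denseRange.preconnectedSpace φ.symm.continuous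
  rcases isClopen_iff.1 (hD.preimage (continuous_subtype_val (p := (· ∈ W)))) with h | h
  · exact Or.inl (eq_empty_of_forall_notMem fun x hx =>
      (h ▸ (show (⟨x, hDW hx⟩ : W) ∈ Subtype.val ⁻¹' D from hx) : _ ∈ (∅ : Set W)))
  · exact Or.inr (hDW.antisymm fun x hx => (h ▸ mem_univ (⟨x, hx⟩ : W) : _ ∈ Subtype.val ⁻¹' D))

/-- A second-countable regularly locally ordered space splits into a sequence of disjoint clopen
sets, each of which is a circle or embeds into the real line. -/
theorem RegularlyLocallyOrdered.exists_partition [SecondCountableTopology X]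
    (hX : RegularlyLocallyOrdered X) :
    ∃ D : ℕ → Set X, (∀ n, IsClopen (D n)) ∧ Pairwise (Function.onFun Disjoint D) ∧
      ⋃ n, D n = univ ∧ ∀ n, (∃ g, IsEmbeddingOn g (D n)) ∨ Nonempty (D n ≃ₜ Circle) := by
  choose W hW hxW hWe using hX.exists_isClopen
  obtain ⟨s, hs, hsU⟩ := TopologicalSpace.countable_cover_nhds fun x =>
    (hW x).isOpen.mem_nhds (hxW x)
  -- Inserting `∅` allows an enumeration by `ℕ` even when X is empty.
  obtain ⟨V, hV⟩ := ((hs.image W).insert ∅).exists_eq_range (insert_nonempty _ _)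
  have hVmem : ∀ n, V n = ∅ ∨ ∃ x, V n = W x := by
    intro n
    have : V n ∈ insert ∅ (W '' s) := hV ▸ mem_range_self n
    rcases this with h | ⟨x, -, h⟩
    · exact Or.inl h
    · exact Or.inr ⟨x, h.symm⟩
  have hVc : ∀ n, IsClopen (V n) := fun n => by
    rcases hVmem n with h | ⟨x, h⟩
    · exact h ▸ isClopen_empty
    · exact h ▸ hW x
  have hD : ∀ n, IsClopen (disjointed V n) := fun n =>
    disjointedRec (p := IsClopen) (fun t i ht => ht.diff (hVc i)) (hVc n)
  refine ⟨disjointed V, hD, disjoint_disjointed V, ?_, fun n => ?_⟩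
  · rw [iUnion_disjointed, ← sUnion_range, ← hV, sUnion_insert, empty_union, sUnion_image, hsU]
  · have hsub : disjointed V n ⊆ V n := disjointed_subset V n
    rcases hVmem n with h | ⟨x, h⟩
    · rw [h, subset_empty_iff] at hsub
      exact Or.inl ⟨0, hsub ▸ isEmbeddingOn_empty _⟩
    · rw [h] at hsub
      rcases hWe x with ⟨g, hg⟩ | ⟨⟨φ⟩⟩
      · exact Or.inl ⟨g, hg.mono hsub⟩
      · rcases eq_empty_or_eq_of_homeomorph_circle φ (hD n) hsub with h | h
        · exact Or.inl ⟨0, h ▸ isEmbeddingOn_empty _⟩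
        · exact Or.inr (h ▸ ⟨φ⟩)

end Decomposition

theorem mainTheorem5 {X : Type*} [TopologicalSpace X] [SecondCountableTopology X]
    (hX : RegularlyLocallyOrdered X) :
    ∃ (ι : Type) (_ : Countable ι) (S : Set ℝ), Nonempty (X ≃ₜ ((Σ _ : ι, Circle) ⊕ S)) := by
  classical
  obtain ⟨D, hD, hdisj, hU, hDe⟩ := hX.exists_partition
  -- Pieces that do not embed in ℝ must be circles; all others are embedded at once, and the image
  -- is taken as `S`.
  let I : Set ℕ := {n | ¬ ∃ g, IsEmbeddingOn g (D n)}
  have hφ : ∀ n : I, Nonempty (D n ≃ₜ Circle) := fun n => (hDe n).resolve_left n.2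
  let φ : ∀ n : I, D n ≃ₜ Circle := fun n => (hφ n).some
  let D' : ℕ → Set X := fun n => if n ∈ I then ∅ else D n
  have hsub : ∀ n, D' n ⊆ D n := fun n => by
    by_cases hn : n ∈ I
    · simp [D', hn]
    · simp [D', hn]
  have hD'o : ∀ n, IsOpen (D' n) := fun n => by
    by_cases hn : n ∈ I
    · simp [D', hn]
    · simpa [D', hn] using (hD n).isOpen
  obtain ⟨g, hg⟩ := exists_isEmbeddingOn_iUnion hD'o
    (fun m n hmn => (hdisj hmn).mono (hsub m) (hsub n)) fun n => by
      by_cases hn : n ∈ I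
      · exact ⟨0, by simpa [D', hn] using isEmbeddingOn_empty _⟩
      · simpa [D', hn] using not_not.1 hn
  have hYo : IsOpen (⋃ n, D' n) := isOpen_iUnion hD'o
  set Y := ⋃ n, D' n with hY
  let ψ : Y ≃ₜ range (Y.domRestrict g) := (isEmbeddingOn_iff.1 hg).toHomeomorph
  refine ⟨I, inferInstance, range (Y.domRestrict g), ⟨Homeomorph.symm ?_⟩⟩
  let F : (Σ _ : I, Circle) ⊕ range (Y.domRestrict g) → X :=
    Sum.elim (fun p => ((φ p.1).symm p.2 : X)) fun s => (ψ.symm s : X)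
  have hφo : ∀ n : I, IsOpenEmbedding fun z => ((φ n).symm z : X) := fun n =>
    (hD n).isOpen.isOpenEmbedding_subtypeVal.comp (φ n).symm.isOpenEmbedding
  have hψo : IsOpenEmbedding fun s => (ψ.symm s : X) :=
    hYo.isOpenEmbedding_subtypeVal.comp ψ.symm.isOpenEmbedding
  have hcont : Continuous F :=
    (continuous_sigma fun n => (hφo n).continuous).sumElim hψo.continuous
  have hopen : IsOpenMap F :=
    isOpenMap_sum.2 ⟨isOpenMap_sigma.2 fun n => (hφo n).isOpenMap, hψo.isOpenMap⟩
  have hne : ∀ (n : I) (x : X), x ∈ D n → x ∉ Y := by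
    intro n x hx hxY
    obtain ⟨m, hm⟩ := mem_iUnion.1 hxY
    have hmn : m = n := by
      by_contra hc
      exact disjoint_left.1 (hdisj hc) (hsub m hm) hx
    rw [hmn] at hm
    simp [D', n.2] at hm
  have hinj : Function.Injective F := by
    rintro (⟨n, z⟩ | s) (⟨m, w⟩ | t) h
    · have h' : ((φ n).symm z : X) = (φ m).symm w := h
      have hnm : n = m := by
        by_contra hc
        refine disjoint_left.1 (hdisj (Subtype.coe_injective.ne hc)) ((φ n).symm z).2 ?_
        rw [h']
        exact ((φ m).symm w).2
      subst hnm
      rw [(hφo n).injective h']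
    · have h' : ((φ n).symm z : X) = ψ.symm t := h
      exact absurd (h' ▸ (ψ.symm t).2) (hne n _ ((φ n).symm z).2)
    · have h' : (ψ.symm s : X) = (φ m).symm w := h
      exact absurd (h' ▸ (ψ.symm s).2) (hne m _ ((φ m).symm w).2)
    · exact congrArg _ (hψo.injective h)
  have hsurj : Function.Surjective F := by
    intro x
    obtain ⟨n, hn⟩ := mem_iUnion.1 (hU ▸ mem_univ x : x ∈ ⋃ n, D n)
    by_cases hnI : n ∈ I
    · exact ⟨Sum.inl ⟨⟨n, hnI⟩, φ ⟨n, hnI⟩ ⟨x, hn⟩⟩, by simp [F]⟩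
    · have hxY : x ∈ Y := mem_iUnion.2 ⟨n, by simpa [D', hnI] using hn⟩
      exact ⟨Sum.inr (ψ ⟨x, hxY⟩), by simp [F]⟩
  exact (Equiv.ofBijective F ⟨hinj, hsurj⟩).toHomeomorphOfContinuousOpen hcont hopen
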